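/- Let $L>1$, $\nu_1,\dots,\nu_N\in\mathbb{R}^2$ with some $\nu_i=0$, put $\Psi_i(x)=x/L+\nu_i$, and let $\mathcal K^{\langle 0\rangle}$ be the unique nonempty compact set with $\mathcal K^{\langle 0\rangle}=\bigcup_i\Psi_i(\mathcal K^{\langle 0\rangle})$. A fixed point $x$ of one of the maps is essential if there are another fixed point $y\neq x$ and $i\ne j$ with $\Psi_i(x)=\Psi_j(y)$; let $V$ be the set of essential fixed points and $k=\#V$. Assume that $\mathcal K^{\langle 0\rangle}$ is a simple nested fractal, that is: $k\ge 2$; there is a nonempty open $U$ with the $\Psi_i(U)$ pairwise disjoint and contained in $U$; $\Psi_i(\mathcal K^{\langle 0\rangle})\cap\Psi_j(\mathcal K^{\langle 0\rangle})=\Psi_i(V)\cap\Psi_j(V)$ for $i\neq j$; for all distinct $x,y\in V$ the reflection in the perpendicular bisector of $[x,y]$ maps each $\Psi_i(V)$ onto some $\Psi_j(V)$; and the graph on $\bigcup_i\Psi_i(V)$ in which two points are adjacent when they lie in a common $\Psi_i(\mathcal K^{\langle 0\rangle})$ is connected. Assume moreover $k\geq 3$ (then $V$ is the vertex set of a regular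 $k$-gon). For $M\in\mathbb Z$ let $\mathcal K^{\langle M\rangle}=L^M\mathcal K^{\langle 0\rangle}$ and $\mathcal K^{\langle\infty\rangle}=\bigcup_{M\ge0}\mathcal K^{\langle M\rangle}$. An $M$-complex is a set $\Delta=\mathcal K^{\langle M\rangle}+\nu_\Delta\subset \mathcal K^{\langle\infty\rangle}$ with $\nu_\Delta=\sum_{j=M+1}^{J}L^j\nu_{i_j}$, $J\ge M+1$; its vertices are the points of $V(\Delta)=L^MV+\nu_\Delta$ and its barycenter is the mean of its vertices. Let $\mathcal A$ be an alphabet of $k$ labels. A good labelling of order $M$ is a map $\ell$ from the vertices of all $M$-complexes to $\mathcal A$ that is a bijection from $L^MV$ onto $\mathcal A$ and such that for every $M$-complex $\Delta$ there is a rotation $R$ around the barycenter of $\mathcal K^{\langle M\rangle}$ by a multiple of $2\pi/k$ with $\ell(v)=\ell(R(v-\nu_\Delta))$ for all $v\in V(\Delta)$. The fractal $\mathcal K^{\langle\infty\rangle}$ has the good labelling property (GLP) if a good labelling of order $M$ exists for some $M\in\mathbb Z$. Let $\mathcal B$ be the barycenter of $\mathcal K^{\langle1\rangle}$. The half-lines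 from $\mathcal B$ through the vertices of $\mathcal K^{\langle 1\rangle}$ bound $k$ angles of measure $2\pi/k$; number them counter-clockwise, cyclically, and let $U_i$ be the $i$-th open angle together with its left (counter-clockwise) edge without $\mathcal B$. The slice $W_i$ consists of those of the $0$-complexes $\mathcal K^{\langle0\rangle}+L\nu_a$ ($1\le a\le N$) of $\mathcal K^{\langle 1\rangle}$ whose barycenter lies in $U_i$. The vertices of a collection of $0$-complexes of $\mathcal K^{\langle1\rangle}$ can be well labelled if there are a bijection $p:V\to\mathcal A$ and a map $\ell$ from these vertices to $\mathcal A$ such that for every complex $\Delta$ of the collection there is a rotation $R$ around the barycenter of $\mathcal K^{\langle 0\rangle}$ by a multiple of $2\pi/k$ with $\ell(v)=p(R(v-\nu_\Delta))$ for all $v\in V(\Delta)$. Theorem. If $k\ne6$, or if $k=6$ and $\mathcal B\notin\mathcal K^{\langle1\rangle}$, then for every $i$: $\mathcal K^{\langle\infty\rangle}$ has GLP if and only if the vertices of the $0$-complexes in $W_i\cup W_{i+1}$ can be well labelled. -/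

import Mathlib

/-- Finitely many similitudes `z ↦ z / L + ν i` of the plane `ℂ = ℝ²` with the common scaling
factor `L > 1`. -/
structure SimilitudeSystem where
  N : ℕ
  N_pos : 0 < N
  L : ℝ
  one_lt_L : 1 < L
  ν : Fin N → ℂ

namespace SimilitudeSystem

variable (S : SimilitudeSystem)

noncomputable section

/-- The similitude `Ψ_i`. -/
def Ψ (i : Fin S.N) (z : ℂ) : ℂ := z / (S.L : ℂ) + S.ν i

theorem continuous_Ψ (i : Fin S.N) : Continuous (S.Ψ i) := by
  unfold Ψ; fun_prop

theorem edist_Ψ_le (i : Fin S.N) (x y : ℂ) :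
    edist (S.Ψ i x) (S.Ψ i y) ≤ ((S.L⁻¹).toNNReal : ENNReal) * edist x y := by
  have h0 : (0 : ℝ) < S.L := lt_trans one_pos S.one_lt_L
  have h : LipschitzWith (S.L⁻¹).toNNReal (S.Ψ i) := by
    refine LipschitzWith.of_dist_le_mul fun x y => ?_
    rw [Real.coe_toNNReal _ (inv_nonneg.2 h0.le), Ψ, Ψ, dist_add_right, dist_eq_norm,
      dist_eq_norm, ← sub_div, norm_div, Complex.norm_real, Real.norm_of_nonneg h0.le,
      div_eq_inv_mul]
  exact h x y

/-- The action of the system on nonempty compact sets. -/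
def hutchinson (C : TopologicalSpace.NonemptyCompacts ℂ) :
    TopologicalSpace.NonemptyCompacts ℂ where
  carrier := ⋃ i, S.Ψ i '' C
  isCompact' := isCompact_iUnion fun i => C.isCompact.image (S.continuous_Ψ i)
  nonempty' := by
    obtain ⟨x, hx⟩ := C.nonempty
    exact ⟨S.Ψ ⟨0, S.N_pos⟩ x, Set.mem_iUnion.2 ⟨_, x, hx, rfl⟩⟩

theorem contracting_hutchinson : ContractingWith (S.L⁻¹).toNNReal S.hutchinson := by
  constructor
  · rw [Real.toNNReal_lt_one]
    exact inv_lt_one_of_one_lt₀ S.one_lt_L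
  · have key : ∀ A B : TopologicalSpace.NonemptyCompacts ℂ, ∀ x ∈ ⋃ i, S.Ψ i '' (A : Set ℂ),
        ∃ y ∈ ⋃ i, S.Ψ i '' (B : Set ℂ), edist x y ≤ ((S.L⁻¹).toNNReal : ENNReal) *
          Metric.hausdorffEDist (A : Set ℂ) B := by
      intro A B x hx
      obtain ⟨i, a, ha, rfl⟩ := Set.mem_iUnion.1 hx
      obtain ⟨b, hb, hab⟩ := B.isCompact.exists_infEDist_eq_edist B.nonempty a
      refine ⟨S.Ψ i b, Set.mem_iUnion.2 ⟨i, b, hb, rfl⟩, (S.edist_Ψ_le i a b).trans ?_⟩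
      gcongr
      rw [← hab]
      exact Metric.infEDist_le_hausdorffEDist_of_mem ha
    intro A B
    refine Metric.hausdorffEDist_le_of_mem_edist (key A B) ?_
    have := key B A
    rw [Metric.hausdorffEDist_comm] at this
    exact this

theorem existsUnique_fractal :
    ∃! K : Set ℂ, K.Nonempty ∧ IsCompact K ∧ K = ⋃ i, S.Ψ i '' K := by
  have : Nonempty (TopologicalSpace.NonemptyCompacts ℂ) := ⟨⟨⟨{0}, isCompact_singleton⟩, by simp⟩⟩
  set C := ContractingWith.fixedPoint S.hutchinson S.contracting_hutchinson with hC
  have hfix : S.hutchinson C = C := S.contracting_hutchinson.fixedPoint_isFixedPt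
  refine ⟨C, ⟨C.nonempty, C.isCompact, (congrArg (fun D : TopologicalSpace.NonemptyCompacts ℂ => (D : Set ℂ)) hfix).symm⟩, ?_⟩
  rintro K ⟨hne, hK, hEq⟩
  let D : TopologicalSpace.NonemptyCompacts ℂ := ⟨⟨K, hK⟩, hne⟩
  have hD : S.hutchinson D = D := TopologicalSpace.NonemptyCompacts.ext hEq.symm
  exact congrArg (fun D : TopologicalSpace.NonemptyCompacts ℂ => (D : Set ℂ)) (S.contracting_hutchinson.fixedPoint_unique hD)

/-- The fractal `K^⟨0⟩` generated by the system: the unique nonempty compact set `K` with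
`K = ⋃ i, Ψ_i(K)`. -/
def fractal : Set ℂ := S.existsUnique_fractal.choose

theorem fractal_spec :
    S.fractal.Nonempty ∧ IsCompact S.fractal ∧ S.fractal = ⋃ i, S.Ψ i '' S.fractal :=
  S.existsUnique_fractal.choose_spec.1

/-- The set `F` of the fixed points of the similitudes. -/
def fixedPoints : Set ℂ := {x | ∃ i, S.Ψ i x = x}

/-- The set `V_0^⟨0⟩` of the essential fixed points. -/
def essential : Set ℂ :=
  {x | x ∈ S.fixedPoints ∧ ∃ y ∈ S.fixedPoints, y ≠ x ∧ ∃ i j, i ≠ j ∧ S.Ψ i x = S.Ψ j y}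

theorem finite_essential : S.essential.Finite := by
  have hsub : S.essential ⊆ ⋃ i : Fin S.N, {x | S.Ψ i x = x} := by
    rintro x ⟨⟨i, hi⟩, -⟩
    exact Set.mem_iUnion.2 ⟨i, hi⟩
  refine (Set.finite_iUnion fun i => Set.Subsingleton.finite fun x hx y hy => ?_).subset hsub
  by_contra hne
  have hx' : S.Ψ i x = x := hx
  have hy' : S.Ψ i y = y := hy
  have h := S.edist_Ψ_le i x y
  rw [hx', hy'] at h
  have h1 : ((S.L⁻¹).toNNReal : ENNReal) < 1 := by
    exact_mod_cast S.contracting_hutchinson.1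
  have h2 := ENNReal.mul_lt_mul_left (edist_pos.2 hne).ne' (edist_ne_top x y) h1
  rw [one_mul] at h2
  exact absurd h (not_le.2 h2)

/-- The number `k` of essential fixed points. -/
def k : ℕ := S.essential.ncard

/-- The symmetry `S_{x,y}` with respect to the line bisecting the segment `[x, y]`
perpendicularly. -/
def bisectorReflection (x y : ℂ) (z : ℂ) : ℂ :=
  haveI : Nonempty (AffineSubspace.perpBisector x y) :=
    ⟨⟨midpoint ℝ x y, AffineSubspace.midpoint_mem_perpBisector x y⟩⟩
  EuclideanGeometry.reflection (AffineSubspace.perpBisector x y) z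

/-- The set `V_{-1}^⟨0⟩`. -/
def innerVertices : Set ℂ := ⋃ i, S.Ψ i '' S.essential

/-- The graph on `V_{-1}^⟨0⟩` in which two points are adjacent when they lie in a common
`Ψ_i(K^⟨0⟩)`. -/
def innerGraph : SimpleGraph S.innerVertices where
  Adj x y := x ≠ y ∧ ∃ i, (x : ℂ) ∈ S.Ψ i '' S.fractal ∧ (y : ℂ) ∈ S.Ψ i '' S.fractal
  symm := ⟨fun _ _ h => ⟨h.1.symm, h.2.imp fun _ hi => ⟨hi.2, hi.1⟩⟩⟩
  loopless := ⟨fun _ h => h.1 rfl⟩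

/-- The fractal generated by the system is a simple nested fractal. -/
structure IsSimpleNestedFractal : Prop where
  two_le : 2 ≤ S.k
  openSet : ∃ U : Set ℂ, IsOpen U ∧ U.Nonempty ∧
    (∀ i j, i ≠ j → S.Ψ i '' U ∩ S.Ψ j '' U = ∅) ∧ (⋃ i, S.Ψ i '' U) ⊆ U
  nesting : ∀ i j, i ≠ j →
    S.Ψ i '' S.fractal ∩ S.Ψ j '' S.fractal = S.Ψ i '' S.essential ∩ S.Ψ j '' S.essential
  symmetry : ∀ i, ∀ x ∈ S.essential, ∀ y ∈ S.essential, x ≠ y →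
    ∃ j, bisectorReflection x y '' (S.Ψ i '' S.essential) = S.Ψ j '' S.essential
  connected : S.innerGraph.Connected

/-- `K^⟨M⟩ = L^M K^⟨0⟩`. -/
def scaled (M : ℤ) : Set ℂ := (fun z => (S.L : ℂ) ^ M * z) '' S.fractal

/-- The unbounded fractal `K^⟨∞⟩`. -/
def unbounded : Set ℂ := ⋃ M : ℕ, S.scaled M

/-- `V(Δ) = L^M V_0^⟨0⟩ + t`: the vertices of the `M`-complex `Δ = K^⟨M⟩ + t`. -/
def vertices (M : ℤ) (t : ℂ) : Set ℂ := (fun z => (S.L : ℂ) ^ M * z + t) '' S.essential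

/-- `K^⟨M⟩ + t` is an `M`-complex: it lies in `K^⟨∞⟩` and `t = ∑_{j=M+1}^{J} L^j ν_{i_j}` for some
`J ≥ M + 1` and some indices `i_j`. -/
def IsComplexShift (M : ℤ) (t : ℂ) : Prop :=
  (fun z => z + t) '' S.scaled M ⊆ S.unbounded ∧
    ∃ J : ℤ, M + 1 ≤ J ∧ ∃ a : ℤ → Fin S.N,
      t = ∑ j ∈ Finset.Icc (M + 1) J, (S.L : ℂ) ^ j * S.ν (a j)

/-- The barycenter of `K^⟨M⟩ + t`: the mean of its vertices, that is, the centre of the polygon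
that they span. -/
def barycenter (M : ℤ) (t : ℂ) : ℂ :=
  ((S.vertices M t).ncard : ℂ)⁻¹ * ∑ᶠ v ∈ S.vertices M t, v

/-- The rotation by the angle `2πj/k` around the barycenter of `K^⟨M⟩`. -/
def rotation (M : ℤ) (j : ℤ) (z : ℂ) : ℂ :=
  S.barycenter M 0 +
    Complex.exp (((2 * Real.pi * j / S.k : ℝ) : ℂ) * Complex.I) * (z - S.barycenter M 0)

/-- `ℓ` is a good labelling function of order `M`, with the alphabet `Fin k`. Only the values of
`ℓ` at the vertices of the `M`-complexes matter. -/
def IsGoodLabelling (M : ℤ) (ℓ : ℂ → Fin S.k) : Prop :=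
  Set.BijOn ℓ (S.vertices M 0) Set.univ ∧
    ∀ t, S.IsComplexShift M t → ∃ j : ℤ, ∀ v ∈ S.vertices M t, ℓ v = ℓ (S.rotation M j (v - t))

/-- The good labelling property. -/
def HasGLP : Prop := ∃ M : ℤ, ∃ ℓ : ℂ → Fin S.k, S.IsGoodLabelling M ℓ

/-- The translation vector of the `0`-complex `K^⟨0⟩ + L ν_a`. The `0`-complexes contained in
`K^⟨1⟩ = ⋃ a, (K^⟨0⟩ + L ν_a)` are these `N` sets; they are referred to by the index `a`. -/
def cellShift (a : Fin S.N) : ℂ := (S.L : ℂ) * S.ν a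

/-- The vertices of the `0`-complexes of `K^⟨1⟩` with index in `C` can be well labelled: each of
these complexes gets the whole alphabet, in the same cyclic order, that is, up to a rotation
its labels are those of one bijective labelling `p` of the vertices of `K^⟨0⟩`. -/
def CanBeWellLabelled (C : Set (Fin S.N)) : Prop :=
  ∃ p ℓ : ℂ → Fin S.k, Set.BijOn p (S.vertices 0 0) Set.univ ∧
    ∀ a ∈ C, ∃ j : ℤ, ∀ v ∈ S.vertices 0 (S.cellShift a),
      ℓ v = p (S.rotation 0 j (v - S.cellShift a))

/-- For a vertex `w` of `K^⟨1⟩`, the `i`-th sector (counter-clockwise from `w`) with apex at the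
barycenter `B` of `K^⟨1⟩`: the open angle of measure `2π/k` between the half-lines from `B` through
two consecutive vertices, together with its left (counter-clockwise) edge, without `B`. -/
def sector (w : ℂ) (i : ℤ) : Set ℂ :=
  {z | ∃ r : ℝ, 0 < r ∧ ∃ θ ∈ Set.Ioc (2 * Real.pi * i / S.k) (2 * Real.pi * (i + 1) / S.k),
    z = S.barycenter 1 0 + r * Complex.exp ((θ : ℂ) * Complex.I) * (w - S.barycenter 1 0)}

/-- The slice `W_i`: the `0`-complexes of `K^⟨1⟩` whose barycenter lies in the `i`-th sector. -/
def slice (w : ℂ) (i : ℤ) : Set (Fin S.N) :=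
  {a | S.barycenter 0 (S.cellShift a) ∈ S.sector w i}

end

end SimilitudeSystem

/-! In a coordinate where the essential fixed points are the `k`-th roots of unity, and on the scale
of the cells, the `0`-complexes of `K^⟨1⟩` are translates `x + K` of one connected set. Their
centres `x` form a set `X` with the symmetries of the `k`-gon, and two translates meet only in
polygon vertices. A labelling of the cells amounts to a potential `j : X → ℤ/k`: the label `m + j x`
of a vertex must not depend on the polygon through which it is seen.

GLP restricts to a potential on any set of cells. Conversely a potential on all of `X` gives GLP
(`hasGLP_of_isPotential`). Potentials on a linked set are unique up to a constant, so the rotations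
of the corner cells are affine in their position. Hence the labels at the corners of `K^⟨n⟩` have
the form `α m + β`, and shifted copies of the labelling of `K^⟨n⟩` fit together on `K^⟨n+1⟩`.

It remains to extend a potential from the two slices to `X`. The symmetry axes cut the plane into
`2k` chambers, and the slices cover three consecutive ones. Reflecting the potential of the middle
chamber in its two walls reproduces the given ones next to it up to constants `d` and `e`. Unfolding
therefore adds `e - d` per rotation by `2π/k`, and after a full turn `k (e - d) = 0` in `ℤ/k`
(`exists_isPotential_of_chambers`).

The gluing needs each vertex of a cell to share a chamber with the centre. If an axis off the centre
cut a cell, the cell and its mirror image would meet along the axis, hence only in vertices; but a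
line that meets `K` only in vertices cannot separate vertices (`not_separated_of_line`). The same
fact, applied to the perpendicular bisector of two centres, fixes the relative position of
neighbouring cells (`exists_of_common_vertex`) and excludes a central cell, which belongs to no
slice, if `k = 5` or `k ≥ 7`. For `k = 6` it is excluded by hypothesis; for `k = 3, 4` a potential
always exists, by a lattice argument. -/

open Complex

/-! ### Roots of unity and axes of symmetry -/

/-- The unit vector in the direction `πh/k`. The vertices of the standard regular `k`-gon are the
points `axis k (2 * m)`, and its axes of symmetry are the lines through `0` and `axis k h`. -/
noncomputable def axis (k : ℕ) (h : ℤ) : ℂ := exp (((Real.pi * h / k : ℝ) : ℂ) * I)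

namespace axis

variable {k : ℕ}

theorem eq_exp (h : ℤ) : axis k h = exp (((Real.pi * h / k : ℝ) : ℂ) * I) := rfl

@[simp] theorem zero : axis k 0 = 1 := by simp [axis]

theorem add (g h : ℤ) : axis k (g + h) = axis k g * axis k h := by
  rw [axis, axis, axis, ← exp_add]; congr 1; push_cast; ring

@[simp] theorem norm_eq (h : ℤ) : ‖axis k h‖ = 1 := norm_exp_ofReal_mul_I _

@[simp] theorem ne_zero (h : ℤ) : axis k h ≠ 0 := exp_ne_zero _

theorem neg (h : ℤ) : axis k (-h) = (axis k h)⁻¹ := by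
  exact eq_inv_of_mul_eq_one_left (by rw [← add]; simp)

@[simp] theorem conj (h : ℤ) : (starRingEnd ℂ) (axis k h) = axis k (-h) := by
  rw [axis, axis, ← exp_conj]; congr 1
  simp only [map_mul, conj_ofReal, conj_I]; push_cast; ring

theorem mul_neg_self (h : ℤ) : axis k h * axis k (-h) = 1 := by
  rw [← add]; simp

theorem neg_mul_self (h : ℤ) : axis k (-h) * axis k h = 1 := by
  rw [← add]; simp

@[simp] theorem self (hk : k ≠ 0) : axis k k = -1 := by
  have : (k : ℝ) ≠ 0 := by exact_mod_cast hk
  rw [axis, ← exp_pi_mul_I]; congr 3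
  push_cast; field_simp

theorem re_eq (h : ℤ) : (axis k h).re = Real.cos (Real.pi * h / k) := exp_ofReal_mul_I_re _

theorem im_eq (h : ℤ) : (axis k h).im = Real.sin (Real.pi * h / k) := exp_ofReal_mul_I_im _

theorem eq_one_iff (hk : k ≠ 0) (m : ℤ) : axis k (2 * m) = 1 ↔ (m : ZMod k) = 0 := by
  have h0 : (k : ℂ) ≠ 0 := by exact_mod_cast hk
  have hpi : (Real.pi : ℂ) ≠ 0 := by exact_mod_cast Real.pi_ne_zero
  rw [axis, exp_eq_one_iff, ZMod.intCast_zmod_eq_zero_iff_dvd]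
  constructor
  · rintro ⟨n, hn⟩
    refine ⟨n, ?_⟩
    push_cast at hn
    field_simp at hn
    exact_mod_cast hn
  · rintro ⟨n, rfl⟩
    refine ⟨n, ?_⟩
    push_cast
    field_simp

theorem vertex_eq_iff (hk : k ≠ 0) (m n : ℤ) :
    axis k (2 * m) = axis k (2 * n) ↔ (m : ZMod k) = n := by
  have h : axis k (2 * m) = axis k (2 * (m - n)) * axis k (2 * n) := by rw [← add]; congr 1; ring
  rw [h, mul_eq_right₀ (ne_zero _), eq_one_iff hk, Int.cast_sub, sub_eq_zero]

theorem vertex_periodic (hk : k ≠ 0) (m n : ℤ) (h : (m : ZMod k) = n) :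
    axis k (2 * m) = axis k (2 * n) := (vertex_eq_iff hk m n).2 h

theorem add_period (hk : k ≠ 0) (h n : ℤ) : axis k (h + 2 * k * n) = axis k h := by
  rw [add, mul_assoc, (eq_one_iff hk (k * n)).2 (by simp), mul_one]

theorem pow (m : ℤ) (n : ℕ) : axis k (m * n) = axis k m ^ n := by
  rw [axis, axis, ← exp_nat_mul]; congr 1; push_cast; ring

theorem isPrimitiveRoot (hk : k ≠ 0) : IsPrimitiveRoot (axis k 2) k := by
  have := Complex.isPrimitiveRoot_exp k hk
  convert this using 1
  rw [axis]; congr 1; push_cast; ring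

theorem vertex_eq_pow (n : ℕ) : axis k (2 * n) = axis k 2 ^ n := pow 2 n

theorem sum_vertex (hk : 2 ≤ k) : ∑ m ∈ Finset.range k, axis k (2 * (m : ℤ)) = 0 := by
  simp_rw [vertex_eq_pow]
  exact (isPrimitiveRoot (by omega)).geom_sum_eq_zero (by omega)

end axis

/-! ### Potentials and linked sets of polygons -/

/-- `j` is a consistent choice of rotations for the regular `k`-gons with circumradius `1` centred
at the points of `C`: giving the `m`-th vertex of the polygon around `x` the label `m + j x`
yields the same label at a common vertex of two polygons. -/
def IsPotential (k : ℕ) (C : Set ℂ) (j : ℂ → ZMod k) : Prop :=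
  ∀ x ∈ C, ∀ y ∈ C, ∀ a b : ℤ, x + axis k (2 * a) = y + axis k (2 * b) →
    (a : ZMod k) + j x = b + j y

/-- Any two points of `C` are joined by a chain of points of `C` such that the polygons around
consecutive points have a common vertex. -/
def IsLinked (k : ℕ) (C : Set ℂ) : Prop :=
  ∀ P : ℂ → Prop, (∃ x ∈ C, P x) → (∀ x ∈ C, ∀ y ∈ C, ∀ a b : ℤ,
    x + axis k (2 * a) = y + axis k (2 * b) → P x → P y) → ∀ x ∈ C, P x

/-- The closed angle between the half-lines from `0` through `axis k h` and `axis k (h + 1)`. -/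
def chamber (k : ℕ) (h : ℤ) : Set ℂ :=
  {z | ∃ r : ℝ, 0 ≤ r ∧ ∃ θ ∈ Set.Icc (Real.pi * h / k) (Real.pi * (h + 1) / k),
    z = r * exp ((θ : ℂ) * I)}

variable {k : ℕ}

namespace IsPotential

theorem mono {C D : Set ℂ} {j : ℂ → ZMod k} (h : IsPotential k D j) (hCD : C ⊆ D) :
    IsPotential k C j :=
  fun x hx y hy => h x (hCD hx) y (hCD hy)

theorem rotate {C : Set ℂ} {j : ℂ → ZMod k} (h : IsPotential k C j) (m : ℤ) :
    IsPotential k {x | axis k (2 * m) * x ∈ C} fun x => j (axis k (2 * m) * x) := by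
  intro x hx y hy a b hab
  have := h _ hx _ hy (m + a) (m + b) (by
    rw [mul_add, mul_add, axis.add, axis.add, ← mul_add, ← mul_add, hab])
  push_cast at this
  linear_combination this

/-- A reflection reverses the cyclic order of the vertices; hence the minus sign. -/
theorem reflect {C : Set ℂ} {j : ℂ → ZMod k} (h : IsPotential k C j) (m : ℤ) :
    IsPotential k {x | axis k (2 * m) * (starRingEnd ℂ) x ∈ C}
      fun x => -j (axis k (2 * m) * (starRingEnd ℂ) x) := by
  intro x hx y hy a b hab
  have := h _ hx _ hy (m - a) (m - b) (by
    have h1 := congrArg (starRingEnd ℂ) hab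
    simp only [map_add, axis.conj] at h1
    rw [show 2 * (m - a) = 2 * m + -(2 * a) by ring, show 2 * (m - b) = 2 * m + -(2 * b) by ring,
      axis.add, axis.add, ← mul_add, ← mul_add, h1])
  push_cast at this
  linear_combination -this

theorem add_const {C : Set ℂ} {j : ℂ → ZMod k} (h : IsPotential k C j) (c : ZMod k) :
    IsPotential k C fun x => j x + c := by
  intro x hx y hy a b hab
  linear_combination h x hx y hy a b hab

theorem congr {C : Set ℂ} {j j' : ℂ → ZMod k} (h : IsPotential k C j)
    (hj : ∀ x ∈ C, j' x = j x) : IsPotential k C j' := by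
  intro x hx y hy a b hab
  rw [hj x hx, hj y hy]
  exact h x hx y hy a b hab

/-- At a common vertex both potentials change by the same amount, so their difference is constant
along chains. -/
theorem exists_eq_add_const {C : Set ℂ} {j j' : ℂ → ZMod k} (hC : IsLinked k C)
    (h : IsPotential k C j) (h' : IsPotential k C j') : ∃ c, ∀ x ∈ C, j' x = j x + c := by
  rcases C.eq_empty_or_nonempty with rfl | ⟨x₀, hx₀⟩
  · exact ⟨0, by simp⟩
  · refine ⟨j' x₀ - j x₀, hC (fun x => j' x = j x + (j' x₀ - j x₀)) ⟨x₀, hx₀, by ring⟩ ?_⟩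
    intro x hx y hy a b hab hP
    linear_combination hP + h x hx y hy a b hab - h' x hx y hy a b hab

end IsPotential

/-! ### Chambers between the axes -/

theorem polar_unique {r s θ φ : ℝ} (hr : 0 < r) (hs : 0 ≤ s)
    (h : (r : ℂ) * exp (θ * I) = s * exp (φ * I)) : r = s ∧ ∃ n : ℤ, θ = φ + n * (2 * Real.pi) := by
  have hrs : r = s := by
    have := congrArg norm h
    simpa [norm_exp_ofReal_mul_I, abs_of_pos hr, abs_of_nonneg hs] using this
  subst hrs
  refine ⟨rfl, ?_⟩
  have h1 : exp (θ * I) = exp (φ * I) := mul_left_cancel₀ (by exact_mod_cast hr.ne') h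
  obtain ⟨n, hn⟩ := exp_eq_exp_iff_exists_int.1 h1
  refine ⟨n, ?_⟩
  have h2 : ((θ : ℂ) - (φ + n * (2 * Real.pi))) * I = 0 := by linear_combination hn
  have h3 := (mul_eq_zero.1 h2).resolve_right I_ne_zero
  have : ((θ - (φ + n * (2 * Real.pi)) : ℝ) : ℂ) = 0 := by push_cast; exact h3
  have := ofReal_eq_zero.1 this
  linarith

namespace chamber

theorem zero_mem (h : ℤ) : (0 : ℂ) ∈ chamber k h := by
  refine ⟨0, le_rfl, Real.pi * h / k, ⟨le_rfl, ?_⟩, by simp⟩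
  have := Real.pi_pos
  gcongr
  linarith

theorem rotate_mem {h m : ℤ} {z : ℂ} (hz : z ∈ chamber k h) : axis k m * z ∈ chamber k (h + m) := by
  obtain ⟨r, hr, θ, ⟨h1, h2⟩, rfl⟩ := hz
  refine ⟨r, hr, θ + Real.pi * m / k, ⟨?_, ?_⟩, ?_⟩
  · push_cast; rw [mul_add, add_div]; linarith
  · push_cast
    have : Real.pi * (h + m + 1) / k = Real.pi * (h + 1) / k + Real.pi * m / k := by ring
    linarith
  · rw [axis.eq_exp, ofReal_add, add_mul, exp_add]; ring

theorem reflect_mem {h m : ℤ} {z : ℂ} (hz : z ∈ chamber k h) :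
    axis k m * (starRingEnd ℂ) z ∈ chamber k (m - 1 - h) := by
  obtain ⟨r, hr, θ, ⟨h1, h2⟩, rfl⟩ := hz
  refine ⟨r, hr, Real.pi * m / k - θ, ⟨?_, ?_⟩, ?_⟩
  · push_cast
    have : Real.pi * (m - 1 - h) / k = Real.pi * m / k - Real.pi * (h + 1) / k := by ring
    linarith
  · push_cast
    have : Real.pi * (m - 1 - h + 1) / k = Real.pi * m / k - Real.pi * h / k := by ring
    linarith
  · rw [axis.eq_exp, ofReal_sub, sub_mul, sub_eq_add_neg, exp_add, map_mul, conj_ofReal, ← exp_conj,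
      map_mul, conj_ofReal, conj_I, mul_neg]
    ring

theorem add_period (hk : k ≠ 0) (h n : ℤ) : chamber k (h + 2 * k * n) = chamber k h := by
  have key : axis k (2 * k * n) = 1 := by simpa using axis.add_period hk 0 n
  have key' : axis k (-(2 * k * n)) = 1 := by rw [axis.neg, key, inv_one]
  ext z
  constructor
  · intro hz
    have := rotate_mem (m := -(2 * k * n)) hz
    rwa [key', one_mul, add_neg_cancel_right] at this
  · intro hz
    have := rotate_mem (m := 2 * k * n) hz
    rwa [key, one_mul] at this

theorem exists_eq_mul_axis (hk : 3 ≤ k) {h : ℤ} {z : ℂ} (h1 : z ∈ chamber k h)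
    (h2 : z ∈ chamber k (h + 1)) : ∃ r : ℝ, z = r * axis k (h + 1) := by
  obtain ⟨r, hr, θ, ⟨a1, a2⟩, rfl⟩ := h1
  obtain ⟨s, hs, φ, ⟨b1, b2⟩, hz⟩ := h2
  rcases hr.eq_or_lt with rfl | hr
  · exact ⟨0, by simp⟩
  obtain ⟨rfl, n, hn⟩ := polar_unique hr hs hz
  have hk' : (3 : ℝ) ≤ k := by exact_mod_cast hk
  have hpi := Real.pi_pos
  have hd : Real.pi / k ≤ Real.pi / 3 := by gcongr
  have e1 : Real.pi * (h + 1) / k = Real.pi * h / k + Real.pi / k := by ring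
  push_cast at b1 b2
  have e2 : Real.pi * (h + 1 + 1) / k = Real.pi * h / k + 2 * (Real.pi / k) := by ring
  rw [e1] at a2 b1
  rw [e2] at b2
  have hn0 : n = 0 := by
    have h3 : (n : ℝ) < 1 := by
      by_contra hc; push Not at hc
      nlinarith
    have h4 : (-1 : ℝ) < n := by
      by_contra hc; push Not at hc
      nlinarith
    have h3' : n < 1 := by exact_mod_cast h3
    have h4' : -1 < n := by exact_mod_cast h4
    omega
  subst hn0
  refine ⟨r, ?_⟩
  have : θ = Real.pi * (h + 1 : ℤ) / k := by
    push_cast; rw [e1]; simp at hn; linarith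
  rw [axis.eq_exp, this]

/-- A quantity attached to the chambers that is the same for two neighbouring chambers which
contain `z` is the same for all chambers which contain `z`. -/
theorem eq_of_mem {α : Type*} (hk : 3 ≤ k) {F : ℤ → α} (hF : ∀ h n : ℤ, F (h + 2 * k * n) = F h)
    {z : ℂ} (hsucc : ∀ h, z ∈ chamber k h → z ∈ chamber k (h + 1) → F h = F (h + 1)) {h h' : ℤ}
    (hz : z ∈ chamber k h) (hz' : z ∈ chamber k h') : F h = F h' := by
  -- All chambers meet at the origin, so there one walks around through neighbours. Elsewhere two
  -- chambers through `z` are equal or adjacent up to a period.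
  by_cases h0 : z = 0
  · subst h0
    have hc : ∀ i : ℤ, F i = F 0 := by
      intro i
      induction i with
      | zero => rfl
      | succ i ih => rw [← hsucc _ (zero_mem _) (zero_mem _), ih]
      | pred i ih =>
        rw [hsucc _ (zero_mem _) (zero_mem _), ← ih]; congr 1; ring
    rw [hc h, hc h']
  have hk' : (3 : ℝ) ≤ k := by exact_mod_cast hk
  have hk0 : k ≠ 0 := by omega
  have hpi := Real.pi_pos
  have hz1 := hz
  have hz2 := hz'
  obtain ⟨r, hr, θ, ⟨a1, a2⟩, rfl⟩ := hz1
  obtain ⟨s, hs, φ, ⟨b1, b2⟩, hzz⟩ := hz2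
  have hr : 0 < r := lt_of_le_of_ne hr fun h => h0 (by simp [← h])
  obtain ⟨rfl, n, hn⟩ := polar_unique hr hs hzz
  have hkp : (0 : ℝ) < k := by linarith
  rw [div_le_iff₀ hkp] at a1 b1
  rw [le_div_iff₀ hkp] at a2 b2
  have l1 : (h : ℝ) ≤ h' + 2 * k * n + 1 := by
    by_contra hc; push Not at hc
    nlinarith
  have l2 : (h' : ℝ) + 2 * k * n ≤ h + 1 := by
    by_contra hc; push Not at hc
    nlinarith
  have l1' : h ≤ h' + 2 * k * n + 1 := by exact_mod_cast l1
  have l2' : h' + 2 * k * n ≤ h + 1 := by exact_mod_cast l2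
  rw [← hF h' n]
  rw [← add_period hk0 h' n] at hz'
  generalize h' + 2 * k * n = g at *
  obtain rfl | rfl | rfl : h = g ∨ h = g + 1 ∨ g = h + 1 := by omega
  · rfl
  · exact (hsucc _ hz' hz).symm
  · exact hsucc _ hz hz'

theorem exists_mem (hk : 0 < k) (z : ℂ) : ∃ h, z ∈ chamber k h := by
  have hkp : (0 : ℝ) < k := by exact_mod_cast hk
  have hpi := Real.pi_pos
  refine ⟨⌊arg z * k / Real.pi⌋, ‖z‖, norm_nonneg z, arg z, ⟨?_, ?_⟩, ?_⟩
  · rw [div_le_iff₀ hkp, mul_comm, ← le_div_iff₀ hpi]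
    exact Int.floor_le _
  · rw [le_div_iff₀ hkp, mul_comm Real.pi, ← div_le_iff₀ hpi]
    exact (Int.lt_floor_add_one _).le
  · exact (norm_mul_exp_arg_mul_I z).symm

theorem reflect_eq_self (hk : 3 ≤ k) {h : ℤ} {z : ℂ} (h1 : z ∈ chamber k h)
    (h2 : z ∈ chamber k (h + 1)) : axis k (2 * (h + 1)) * (starRingEnd ℂ) z = z := by
  obtain ⟨r, rfl⟩ := exists_eq_mul_axis hk h1 h2
  rw [map_mul, conj_ofReal, axis.conj, mul_left_comm, ← axis.add]
  congr 2; ring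

end chamber

/-! ### Folding the plane onto one chamber -/

/-- The symmetry of the `k`-gon that maps the chamber with index `h` to the one with index `0`. -/
noncomputable def fold (k : ℕ) (h : ℤ) (z : ℂ) : ℂ :=
  if Even h then axis k (-h) * z else axis k (h + 1) * (starRingEnd ℂ) z

namespace fold

theorem zero (z : ℂ) : fold k 0 z = z := by simp [fold]

theorem mem_chamber {h : ℤ} {z : ℂ} (hz : z ∈ chamber k h) : fold k h z ∈ chamber k 0 := by
  unfold fold
  split_ifs
  · simpa using chamber.rotate_mem (m := -h) hz
  · simpa using chamber.reflect_mem (m := h + 1) hz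

theorem add_period (hk : k ≠ 0) (h n : ℤ) (z : ℂ) : fold k (h + 2 * k * n) z = fold k h z := by
  have he : Even (h + 2 * k * n) ↔ Even h := by
    rw [Int.even_add, mul_assoc]; simp
  have e1 : axis k (-(h + 2 * k * n)) = axis k (-h) := by
    rw [← axis.add_period hk (-h) (-n)]; congr 1; ring
  have e2 : axis k (h + 2 * k * n + 1) = axis k (h + 1) := by
    rw [← axis.add_period hk (h + 1) n]; congr 1; ring
  simp only [fold, he, e1, e2]

/-- The two foldings differ by the reflection in the common wall, which fixes the wall pointwise. -/
theorem succ (hk : 3 ≤ k) {h : ℤ} {z : ℂ} (h1 : z ∈ chamber k h) (h2 : z ∈ chamber k (h + 1)) :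
    fold k h z = fold k (h + 1) z := by
  have key := chamber.reflect_eq_self hk h1 h2
  by_cases he : Even h
  · have ho : ¬ Even (h + 1) := by rw [Int.even_add_one]; exact not_not.2 he
    rw [fold, fold, if_pos he, if_neg ho]
    conv_lhs => rw [← key]
    rw [← mul_assoc, ← axis.add]
    congr 2; ring
  · have ho : Even (h + 1) := Int.even_add_one.2 he
    rw [fold, fold, if_neg he, if_pos ho]
    conv_rhs => rw [← key]
    rw [← mul_assoc, ← axis.add]
    congr 2; ring

theorem eq_of_mem (hk : 3 ≤ k) {h h' : ℤ} {z : ℂ} (h1 : z ∈ chamber k h) (h2 : z ∈ chamber k h') :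
    fold k h z = fold k h' z :=
  chamber.eq_of_mem (F := fun h => fold k h z) hk (fun h n => add_period (by omega) h n z)
    (fun _ => succ hk) h1 h2

theorem add_vertex (h : ℤ) : ∃ s : ℤ → ℤ, ∀ (x : ℂ) (a : ℤ),
    fold k h (x + axis k (2 * a)) = fold k h x + axis k (2 * s a) := by
  by_cases he : Even h
  · obtain ⟨m, rfl⟩ := he
    refine ⟨fun a => a - m, fun x a => ?_⟩
    simp only [fold, if_pos (show Even (m + m) from ⟨m, rfl⟩)]
    rw [mul_add, ← axis.add]; congr 2; ring
  · obtain ⟨m, hm⟩ := Int.not_even_iff_odd.1 he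
    refine ⟨fun a => m + 1 - a, fun x a => ?_⟩
    simp only [fold, if_neg he]
    rw [map_add, axis.conj, mul_add, ← axis.add, hm]; congr 2; ring

end fold

/-! ### Extending a potential from three chambers -/

section gluing

variable {X : Set ℂ}

theorem rotate_mem_of_reflect_mem
    (hrefl : ∀ h : ℤ, ∀ x ∈ X, axis k (2 * h) * (starRingEnd ℂ) x ∈ X)
    (h : ℤ) {x : ℂ} (hx : x ∈ X) : axis k (2 * h) * x ∈ X := by
  have := hrefl h _ (hrefl 0 x hx)
  simpa using this

theorem fold_mem_of_reflect_mem
    (hrefl : ∀ h : ℤ, ∀ x ∈ X, axis k (2 * h) * (starRingEnd ℂ) x ∈ X)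
    (h : ℤ) {x : ℂ} (hx : x ∈ X) : fold k h x ∈ X := by
  by_cases he : Even h
  · obtain ⟨m, rfl⟩ := he
    rw [fold, if_pos ⟨m, rfl⟩, show -(m + m) = 2 * (-m) by ring]
    exact rotate_mem_of_reflect_mem hrefl _ hx
  · obtain ⟨m, hm⟩ := Int.not_even_iff_odd.1 he
    rw [fold, if_neg he, show h + 1 = 2 * (m + 1) by omega]
    exact hrefl _ _ hx

/-- Every polygon with a centre in `X` has each of its vertices in a common chamber with its
centre. -/
def IsChambered (k : ℕ) (X : Set ℂ) : Prop :=
  ∀ x ∈ X, ∀ m : ℤ, ∃ h, x ∈ chamber k h ∧ x + axis k (2 * m) ∈ chamber k h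

/-- A chain in `X` folds to a chain in chamber `0`: each of two neighbouring cells is folded by a
chamber containing both its centre and the common vertex, and the two foldings agree at that vertex.
-/
theorem isLinked_inter_chamber (hk : 3 ≤ k)
    (hrefl : ∀ h : ℤ, ∀ x ∈ X, axis k (2 * h) * (starRingEnd ℂ) x ∈ X)
    (hX : IsLinked k X) (hch : IsChambered k X) :
    IsLinked k (X ∩ chamber k 0) := by
  intro P hP hadj x hx
  have key := hX (fun x => ∀ h, x ∈ chamber k h → P (fold k h x)) ?_ ?_ x hx.1 0 hx.2
  · rwa [fold.zero] at key
  · obtain ⟨y, hy, hPy⟩ := hP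
    refine ⟨y, hy.1, fun h hh => ?_⟩
    rwa [fold.eq_of_mem hk hh hy.2, fold.zero]
  · intro x hx y hy a b hab hPx h hyh
    obtain ⟨h₁, hx₁, hv₁⟩ := hch x hx a
    obtain ⟨h₂, hy₂, hv₂⟩ := hch y hy b
    obtain ⟨s₁, hs₁⟩ := fold.add_vertex (k := k) h₁
    obtain ⟨s₂, hs₂⟩ := fold.add_vertex (k := k) h₂
    rw [fold.eq_of_mem hk hyh hy₂]
    refine hadj (fold k h₁ x) ⟨fold_mem_of_reflect_mem hrefl _ hx, fold.mem_chamber hx₁⟩ _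
      ⟨fold_mem_of_reflect_mem hrefl _ hy, fold.mem_chamber hy₂⟩ (s₁ a) (s₂ b) ?_ (hPx h₁ hx₁)
    rw [← hs₁, ← hs₂, ← hab]
    rw [← hab] at hv₂
    exact fold.eq_of_mem hk hv₁ hv₂

/-- The potential on the chamber with index `h` obtained from a potential `g` on the chamber with
index `0` by symmetry. -/
noncomputable def unfolded (k : ℕ) (g : ℂ → ZMod k) (c d : ZMod k) (h : ℤ) (x : ℂ) : ZMod k :=
  if Even h then g (fold k h x) + ((h / 2 : ℤ) : ZMod k) * c
  else -g (fold k h x) + (((h + 1) / 2 : ℤ) : ZMod k) * c + d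

/-- A full turn adds `k * c`, which vanishes in `ZMod k`: unfolding has no monodromy. -/
theorem unfolded_add_period (hk : k ≠ 0) (g : ℂ → ZMod k) (c d : ZMod k) (h n : ℤ) :
    unfolded k g c d (h + 2 * k * n) = unfolded k g c d h := by
  have he : Even (h + 2 * k * n) ↔ Even h := by
    rw [Int.even_add, mul_assoc]; simp
  have e1 : (h + 2 * k * n) / 2 = h / 2 + k * n := by
    rw [mul_assoc, Int.add_mul_ediv_left _ _ two_ne_zero]
  have e2 : (h + 2 * k * n + 1) / 2 = (h + 1) / 2 + k * n := by
    rw [add_right_comm, mul_assoc, Int.add_mul_ediv_left _ _ two_ne_zero]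
  funext x
  simp only [unfolded, he, e1, e2, fold.add_period hk]
  simp

theorem unfolded_add_two_mul (g : ℂ → ZMod k) (c d : ZMod k) (h m : ℤ) (x : ℂ) :
    unfolded k g c d (h + 2 * m) x = unfolded k g c d h (axis k (2 * (-m)) * x) + m * c := by
  have he : Even (h + 2 * m) ↔ Even h := by
    rw [Int.even_add]; simp
  have e1 : (h + 2 * m) / 2 = h / 2 + m := Int.add_mul_ediv_left _ _ two_ne_zero
  have e2 : (h + 2 * m + 1) / 2 = (h + 1) / 2 + m := by
    rw [add_right_comm, Int.add_mul_ediv_left _ _ two_ne_zero]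
  have e3 : fold k (h + 2 * m) x = fold k h (axis k (2 * (-m)) * x) := by
    simp only [fold, he]
    split_ifs
    · rw [← mul_assoc, ← axis.add]; congr 2; ring
    · rw [map_mul, axis.conj, ← mul_assoc, ← axis.add]; congr 2; ring
  simp only [unfolded, he, e1, e2, e3]
  split_ifs <;> push_cast <;> ring

/-- A consistent choice of rotations on three consecutive chambers, the second one of which begins
at a vertex, can be extended to all chambers. -/
theorem exists_isPotential_of_chambers (hk : 3 ≤ k)
    (hrefl : ∀ h : ℤ, ∀ x ∈ X, axis k (2 * h) * (starRingEnd ℂ) x ∈ X)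
    (hX : IsLinked k X) (hch : IsChambered k X)
    {g : ℂ → ZMod k}
    (hg : IsPotential k (X ∩ (chamber k (-1) ∪ chamber k 0 ∪ chamber k 1)) g) :
    ∃ f, IsPotential k X f := by
  have hk0 : k ≠ 0 := by omega
  have hL := isLinked_inter_chamber hk hrefl hX hch
  have g0 : IsPotential k (X ∩ chamber k 0) g := hg.mono fun x hx => ⟨hx.1, .inl (.inr hx.2)⟩
  have hrev : ∀ (m : ℤ) (x : ℂ), axis k (2 * m) * (starRingEnd ℂ) (axis k (2 * m) *
      (starRingEnd ℂ) x) = x := by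
    intro m x
    rw [map_mul, axis.conj, conj_conj, ← mul_assoc, axis.mul_neg_self, one_mul]
  -- On a neighbouring chamber the reflected potential differs from `g` by a constant.
  have hside : ∀ m : ℤ, m = 0 ∨ m = 1 → ∃ e, ∀ x ∈ X ∩ chamber k (2 * m - 1),
      g x = -g (axis k (2 * m) * (starRingEnd ℂ) x) + e := by
    intro m hm
    have h1 : IsPotential k (X ∩ chamber k 0)
        fun x => -g (axis k (2 * m) * (starRingEnd ℂ) x) := by
      refine (hg.reflect m).mono fun x hx => ⟨hrefl _ _ hx.1, ?_⟩
      have := chamber.reflect_mem (m := 2 * m) hx.2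
      rcases hm with rfl | rfl
      · exact .inl (.inl (by simpa using this))
      · exact .inr (by simpa using this)
    obtain ⟨e, he⟩ := g0.exists_eq_add_const hL h1
    refine ⟨-e, fun x hx => ?_⟩
    have := he (axis k (2 * m) * (starRingEnd ℂ) x) ⟨hrefl _ _ hx.1, by
      have := chamber.reflect_mem (m := 2 * m) hx.2
      rwa [show 2 * m - 1 - (2 * m - 1) = 0 by ring] at this⟩
    rw [hrev] at this
    linear_combination -this
  obtain ⟨d, hd⟩ := hside 0 (.inl rfl)
  obtain ⟨e, he⟩ := hside 1 (.inr rfl)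
  -- The constants make `G` equal to `g` on the chambers `-1`, `0` and `1`; `e - d` is the increment
  -- for the rotation composed of the two wall reflections.
  set G := unfolded k g (e - d) d with hG
  have G0 : ∀ x, G 0 x = g x := fun x => by simp [hG, unfolded, fold.zero]
  have Gn : ∀ x ∈ X ∩ chamber k (-1), G (-1) x = g x := by
    intro x hx
    rw [hd x (by simpa using hx), hG]
    simp [unfolded, fold]
  have G1 : ∀ x ∈ X ∩ chamber k 1, G 1 x = g x := by
    intro x hx
    rw [he x (by simpa using hx), hG]
    simp only [unfolded, fold, Int.not_even_one, if_false]
    norm_num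
    ring
  have hper : ∀ h n : ℤ, G (h + 2 * k * n) = G h := unfolded_add_period hk0 g _ _
  have hrot : ∀ (h m : ℤ) (x : ℂ), G (h + 2 * m) x = G h (axis k (2 * (-m)) * x) + m * (e - d) :=
    unfolded_add_two_mul g _ _
  have hmem_rot : ∀ (h m : ℤ), ∀ x ∈ X ∩ chamber k (h + 2 * m),
      axis k (2 * (-m)) * x ∈ X ∩ chamber k h := by
    intro h m x hx
    refine ⟨rotate_mem_of_reflect_mem hrefl _ hx.1, ?_⟩
    have := chamber.rotate_mem (m := 2 * (-m)) hx.2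
    rwa [show h + 2 * m + 2 * -m = h by ring] at this
  -- Up to rotation by a multiple of `2π/k`, the only pairs of neighbouring chambers are `(-1, 0)`
  -- and `(0, 1)`.
  have base : ∀ h : ℤ, h = -1 ∨ h = 0 →
      ∀ x ∈ X ∩ chamber k h, ∀ y ∈ X ∩ chamber k (h + 1), ∀ a b : ℤ,
        x + axis k (2 * a) = y + axis k (2 * b) → (a : ZMod k) + G h x = b + G (h + 1) y := by
    rintro h (rfl | rfl) x hx y hy a b hab
    · rw [Gn x hx, show (-1 : ℤ) + 1 = 0 by norm_num, G0]
      exact hg x ⟨hx.1, .inl (.inl hx.2)⟩ y ⟨hy.1, .inl (.inr hy.2)⟩ a b hab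
    · rw [zero_add] at hy ⊢
      rw [G0, G1 y hy]
      exact hg x ⟨hx.1, .inl (.inr hx.2)⟩ y ⟨hy.1, .inr hy.2⟩ a b hab
  have hdecomp : ∀ h : ℤ, ∃ h₀ m : ℤ, (h₀ = -1 ∨ h₀ = 0) ∧ h = h₀ + 2 * m := by
    intro h
    rcases Int.even_or_odd' h with ⟨m, hm | hm⟩
    · exact ⟨0, m, .inr rfl, by omega⟩
    · exact ⟨-1, m + 1, .inl rfl, by omega⟩
  have hcompat : ∀ h : ℤ, ∀ x ∈ X ∩ chamber k h, ∀ y ∈ X ∩ chamber k (h + 1), ∀ a b : ℤ,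
      x + axis k (2 * a) = y + axis k (2 * b) → (a : ZMod k) + G h x = b + G (h + 1) y := by
    intro h x hx y hy a b hab
    obtain ⟨h₀, m, hh₀, rfl⟩ := hdecomp h
    rw [show h₀ + 2 * m + 1 = h₀ + 1 + 2 * m by ring] at hy ⊢
    rw [hrot, hrot]
    have := base h₀ hh₀ _ (hmem_rot _ _ x hx) _ (hmem_rot _ _ y hy) (-m + a) (-m + b) (by
      rw [mul_add, mul_add, axis.add, axis.add, ← mul_add, ← mul_add, hab])
    push_cast at this
    linear_combination this
  have hpot : ∀ h : ℤ, IsPotential k (X ∩ chamber k h) (G h) := by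
    intro h x hx y hy a b hab
    obtain ⟨h₀, m, hh₀, rfl⟩ := hdecomp h
    rw [hrot, hrot]
    have hbase : IsPotential k (X ∩ chamber k h₀) (G h₀) := by
      rcases hh₀ with rfl | rfl
      · exact (hg.mono fun x hx => ⟨hx.1, .inl (.inl hx.2)⟩).congr Gn
      · exact g0.congr fun x _ => G0 x
    have := hbase _ (hmem_rot _ _ x hx) _ (hmem_rot _ _ y hy) (-m + a) (-m + b) (by
      rw [mul_add, mul_add, axis.add, axis.add, ← mul_add, ← mul_add, hab])
    push_cast at this
    linear_combination this
  have hindep : ∀ x ∈ X, ∀ h h' : ℤ, x ∈ chamber k h → x ∈ chamber k h' → G h x = G h' x := by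
    intro x hx h h' hxh hxh'
    refine chamber.eq_of_mem (F := fun h => G h x) hk (fun h n => by rw [hper]) ?_ hxh hxh'
    intro h h1 h2
    simpa using hcompat h x ⟨hx, h1⟩ x ⟨hx, h2⟩ 0 0 rfl
  -- Chambers sharing `v` need not be adjacent if `v = 0`, so the label travels through intermediate
  -- chambers. Reflection in a wall fixes `v` on it and supplies a polygon with vertex `v` on the
  -- other side.
  have hlabel : ∀ (v : ℂ) (s : ZMod k) (h h' : ℤ), v ∈ chamber k h → v ∈ chamber k h' →
      (∃ x ∈ X ∩ chamber k h, ∃ a : ℤ, v = x + axis k (2 * a) ∧ a + G h x = s) →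
      ∃ x ∈ X ∩ chamber k h', ∃ a : ℤ, v = x + axis k (2 * a) ∧ a + G h' x = s := by
    intro v s h h' hv hv' H
    refine (chamber.eq_of_mem (F := fun h => ∃ x ∈ X ∩ chamber k h, ∃ a : ℤ,
      v = x + axis k (2 * a) ∧ a + G h x = s) hk (fun h n => ?_) ?_ hv hv').mp H
    · simp only [hper, chamber.add_period hk0]
    · intro h hv₁ hv₂
      have hfix := chamber.reflect_eq_self hk hv₁ hv₂
      have hv' : ∀ (x : ℂ) (a : ℤ), v = x + axis k (2 * a) →
          v = axis k (2 * (h + 1)) * (starRingEnd ℂ) x + axis k (2 * (h + 1 - a)) := by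
        intro x a hxa
        rw [← hfix, hxa, map_add, axis.conj, mul_add, ← axis.add]
        congr 2; ring
      refine propext ⟨?_, ?_⟩
      · rintro ⟨x, hx, a, hxa, rfl⟩
        have hx' : axis k (2 * (h + 1)) * (starRingEnd ℂ) x ∈ X ∩ chamber k (h + 1) :=
          ⟨hrefl _ _ hx.1, by
            have := chamber.reflect_mem (m := 2 * (h + 1)) hx.2
            rwa [show 2 * (h + 1) - 1 - h = h + 1 by ring] at this⟩
        exact ⟨_, hx', h + 1 - a, hv' x a hxa,
          (hcompat h x hx _ hx' a _ (by rw [← hxa, ← hv' x a hxa])).symm⟩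
      · rintro ⟨x, hx, a, hxa, rfl⟩
        have hx' : axis k (2 * (h + 1)) * (starRingEnd ℂ) x ∈ X ∩ chamber k h :=
          ⟨hrefl _ _ hx.1, by
            have := chamber.reflect_mem (m := 2 * (h + 1)) hx.2
            rwa [show 2 * (h + 1) - 1 - (h + 1) = h by ring] at this⟩
        exact ⟨_, hx', h + 1 - a, hv' x a hxa,
          hcompat h _ hx' x hx _ a (by rw [← hxa, ← hv' x a hxa])⟩
  choose H hH using fun z : ℂ => chamber.exists_mem (show 0 < k by omega) z
  refine ⟨fun x => G (H x) x, fun x hx y hy a b hab => ?_⟩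
  obtain ⟨h₁, hx₁, hv₁⟩ := hch x hx a
  obtain ⟨h₂, hy₂, hv₂⟩ := hch y hy b
  obtain ⟨x', hx', a', hxa', hs⟩ := hlabel _ _ h₁ h₂ hv₁ (by rwa [hab])
    ⟨x, ⟨hx, hx₁⟩, a, rfl, rfl⟩
  change (a : ZMod k) + G (H x) x = b + G (H y) y
  rw [hindep x hx (H x) h₁ (hH x) hx₁, hindep y hy (H y) h₂ (hH y) hy₂, ← hs]
  exact hpot h₂ x' hx' y ⟨hy, hy₂⟩ a' b (by rw [← hxa', hab])

end gluing

/-! ### Lines that meet the fractal only in vertices -/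

/-- If a continuous function vanishes at a single point of a preconnected set, then the part of
the set where the function is not positive is preconnected. -/
theorem IsPreconnected.inter_nonpos {α : Type*} [TopologicalSpace α] {K : Set α}
    (hK : IsPreconnected K) {f : α → ℝ} (hf : Continuous f) {p : α} (hp : p ∈ K) (hfp : f p = 0)
    (h0 : ∀ z ∈ K, f z = 0 → z = p) : IsPreconnected (K ∩ {z | f z ≤ 0}) := by
  have key : ∀ t t' : Set α, IsClosed t → IsClosed t' → K ∩ {z | f z ≤ 0} ⊆ t ∪ t' → p ∈ t →
      (K ∩ {z | f z ≤ 0} ∩ t').Nonempty → (K ∩ {z | f z ≤ 0} ∩ (t ∩ t')).Nonempty := by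
    rintro t t' ht ht' hsub hpt ⟨q, ⟨hqK, hq⟩, hqt'⟩
    have hle : IsClosed {z | f z ≤ 0} := isClosed_le hf continuous_const
    have hge : IsClosed {z | 0 ≤ f z} := isClosed_le continuous_const hf
    -- The other half of `K` is added to the part containing the cut point, so that a separation of
    -- one half would separate `K`.
    have hcov : K ⊆ ((t ∩ {z | f z ≤ 0}) ∪ {z | 0 ≤ f z}) ∪ (t' ∩ {z | f z ≤ 0}) := by
      intro z hz
      rcases le_total (f z) 0 with h | h
      · rcases hsub ⟨hz, h⟩ with h' | h'
        · exact .inl (.inl ⟨h', h⟩)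
        · exact .inr ⟨h', h⟩
      · exact .inl (.inr h)
    obtain ⟨z, hzK, hz1, hz2, hz3⟩ := isPreconnected_closed_iff.1 hK _ _
      ((ht.inter hle).union hge) (ht'.inter hle) hcov ⟨p, hp, .inl ⟨hpt, hfp.le⟩⟩
      ⟨q, hqK, hqt', hq⟩
    refine ⟨z, ⟨hzK, hz3⟩, ?_, hz2⟩
    rcases hz1 with hz1 | hz1
    · exact hz1.1
    · rwa [h0 z hzK (le_antisymm hz3 hz1)]
  refine isPreconnected_closed_iff.2 fun t t' ht ht' hsub h1 h2 => ?_
  rcases hsub ⟨hp, hfp.le⟩ with hpt | hpt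
  · exact key t t' ht ht' hsub hpt h2
  · rw [Set.inter_comm t t']
    exact key t' t ht' ht (by rwa [Set.union_comm]) hpt h1

/-- A connected set `K` with the symmetries of the standard regular `k`-gon that contains its
vertices, and a set `X` of centres such that the translates `x + K`, `x ∈ X`, only meet in vertices
of the `k`-gons around the centres. -/
structure IsPolygonFractal (k : ℕ) (L : ℝ) (K X : Set ℂ) : Prop where
  three_le : 3 ≤ k
  one_lt : 1 < L
  isPreconnected : IsPreconnected K
  vertex_mem : ∀ m : ℤ, axis k (2 * m) ∈ K
  segment_mem : ∀ m n : ℤ,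
    axis k (2 * m) + (axis k (2 * n) - axis k (2 * m)) / (L : ℂ) ∈ K
  reflect_mem : ∀ h : ℤ, ∀ z ∈ K, axis k (2 * h) * (starRingEnd ℂ) z ∈ K
  reflect_center_mem : ∀ h : ℤ, ∀ x ∈ X, axis k (2 * h) * (starRingEnd ℂ) x ∈ X
  nesting : ∀ x ∈ X, ∀ y ∈ X, x ≠ y → ∀ z ∈ K, ∀ z' ∈ K, x + z = y + z' →
    ∃ m : ℤ, z = axis k (2 * m)
  isLinked : IsLinked k X
  exists_ne_zero : ∃ x ∈ X, x ≠ 0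

/-- The vertices of a regular polygon lie in the angle at one of them that is spanned by its
neighbours. -/
theorem axis.vertex_sub_one (k : ℕ) (j : ℤ) :
    ((Real.sin (2 * (Real.pi / k)) * Real.sin (Real.pi / k) : ℝ) : ℂ) * (axis k (2 * j) - 1) =
      ((Real.sin (Real.pi * j / k) * Real.sin (Real.pi * (j + 1) / k) : ℝ) : ℂ) * (axis k 2 - 1) +
      ((Real.sin (Real.pi * j / k) * Real.sin (Real.pi * (j - 1) / k) : ℝ) : ℂ) *
        (axis k (-2) - 1) := by
  have e1 : Real.pi * (j + 1) / k = Real.pi * j / k + Real.pi / k := by ring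
  have e2 : Real.pi * (j - 1) / k = Real.pi * j / k - Real.pi / k := by ring
  have e3 : Real.pi * (2 * j : ℤ) / k = 2 * (Real.pi * j / k) := by push_cast; ring
  have e4 : Real.pi * (2 : ℤ) / k = 2 * (Real.pi / k) := by push_cast; ring
  have e5 : Real.pi * (-2 : ℤ) / k = -(2 * (Real.pi / k)) := by push_cast; ring
  rw [e1, e2]
  have h1 := Real.sin_sq_add_cos_sq (Real.pi / k)
  have h2 := Real.sin_sq_add_cos_sq (Real.pi * j / k)
  apply Complex.ext
  · simp only [add_re, re_ofReal_mul, sub_re, one_re, axis.re_eq, e3, e4, e5, Real.cos_neg]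
    rw [Real.cos_two_mul', Real.cos_two_mul', Real.sin_two_mul, Real.sin_add, Real.sin_sub]
    generalize Real.sin (Real.pi / k) = s at *
    generalize Real.cos (Real.pi / k) = c at *
    generalize Real.sin (Real.pi * j / k) = S at *
    generalize Real.cos (Real.pi * j / k) = C at *
    linear_combination (2 * s ^ 2 * c) * h2 - (2 * S ^ 2 * c) * h1
  · simp only [add_im, im_ofReal_mul, sub_im, one_im, axis.im_eq, e3, e4, e5, Real.sin_neg]
    rw [Real.sin_two_mul, Real.sin_two_mul, Real.sin_add, Real.sin_sub]
    ring

theorem axis.sin_pi_mul_nonneg {k : ℕ} {j : ℤ} (h0 : 0 ≤ j) (h1 : j ≤ k) :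
    0 ≤ Real.sin (Real.pi * j / k) := by
  have hpi := Real.pi_pos
  have h0' : (0 : ℝ) ≤ j := by exact_mod_cast h0
  have h1' : (j : ℝ) ≤ k := by exact_mod_cast h1
  refine Real.sin_nonneg_of_nonneg_of_le_pi (by positivity) ?_
  rw [mul_div_assoc]
  exact mul_le_of_le_one_right hpi.le (div_le_one_of_le₀ h1' (by positivity))

theorem axis.exists_nat_lt {k : ℕ} (hk : k ≠ 0) (m : ℤ) :
    ∃ j : ℤ, 0 ≤ j ∧ j < k ∧ axis k (2 * m) = axis k (2 * j) := by
  have hk' : (k : ℤ) ≠ 0 := by exact_mod_cast hk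
  refine ⟨m % k, Int.emod_nonneg _ hk', Int.emod_lt_of_pos _ (by omega), ?_⟩
  exact axis.vertex_periodic hk _ _ (by simp)

/-- A half-plane through a vertex of a regular polygon which contains the neighbours of this
vertex contains all vertices. -/
theorem axis.im_mul_vertex_nonneg {k : ℕ} (hk : 3 ≤ k) {c : ℂ} (h1 : 0 ≤ (c * (axis k 2 - 1)).im)
    (h2 : 0 ≤ (c * (axis k (-2) - 1)).im) (m : ℤ) : 0 ≤ (c * (axis k (2 * m) - 1)).im := by
  obtain ⟨j, hj0, hjk, hj⟩ := axis.exists_nat_lt (show k ≠ 0 by omega) m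
  rw [hj]
  rcases hj0.eq_or_lt with rfl | hj0
  · simp
  have key := congrArg (fun z => (c * z).im) (axis.vertex_sub_one k j)
  simp only [mul_add c, mul_left_comm c, add_im, im_ofReal_mul] at key
  have hk' : (3 : ℝ) ≤ k := by exact_mod_cast hk
  have hpi := Real.pi_pos
  have hd : Real.pi / k ≤ Real.pi / 3 := by gcongr
  have hd0 : 0 < Real.pi / k := by positivity
  have hpos : 0 < Real.sin (2 * (Real.pi / k)) * Real.sin (Real.pi / k) :=
    mul_pos (Real.sin_pos_of_pos_of_lt_pi (by linarith) (by linarith))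
      (Real.sin_pos_of_pos_of_lt_pi hd0 (by linarith))
  refine nonneg_of_mul_nonneg_right ?_ hpos
  rw [key]
  have s1 := axis.sin_pi_mul_nonneg (k := k) hj0.le hjk.le
  have s2 := axis.sin_pi_mul_nonneg (k := k) (j := j + 1) (by omega) (by omega)
  have s3 := axis.sin_pi_mul_nonneg (k := k) (j := j - 1) (by omega) (by omega)
  rw [Int.cast_add, Int.cast_one] at s2
  rw [Int.cast_sub, Int.cast_one] at s3
  exact add_nonneg (mul_nonneg (mul_nonneg s1 s2) h1) (mul_nonneg (mul_nonneg s1 s3) h2)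

namespace IsPolygonFractal

variable {k : ℕ} {L : ℝ} {K X : Set ℂ}

theorem ne_zero (hF : IsPolygonFractal k L K X) : k ≠ 0 := by have := hF.three_le; omega

theorem rotate_mem (hF : IsPolygonFractal k L K X) (h : ℤ) {z : ℂ} (hz : z ∈ K) :
    axis k (2 * h) * z ∈ K :=
  rotate_mem_of_reflect_mem hF.reflect_mem h hz

/-- A line that meets the fractal only in vertices passes through at most one vertex. -/
theorem vertex_unique_of_line (hF : IsPolygonFractal k L K X) {c : ℂ} {t : ℝ}
    (hl : ∀ z ∈ K, (c * z).im + t = 0 → ∃ m : ℤ, z = axis k (2 * m)) {m n : ℤ}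
    (hm : (c * axis k (2 * m)).im + t = 0) (hn : (c * axis k (2 * n)).im + t = 0) :
    axis k (2 * m) = axis k (2 * n) := by
  by_contra hne
  have hL := hF.one_lt
  have hL0 : 0 < L := by linarith
  -- This point of `K` would lie on the line too, but strictly inside the unit circle, so it is no
  -- vertex.
  have e : axis k (2 * m) + (axis k (2 * n) - axis k (2 * m)) / (L : ℂ) =
      (1 - L⁻¹ : ℝ) • axis k (2 * m) + (L⁻¹ : ℝ) • axis k (2 * n) := by
    simp only [real_smul]; push_cast; ring
  obtain ⟨j, hj⟩ := hl _ (hF.segment_mem m n) (by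
    rw [e, mul_add, mul_smul_comm, mul_smul_comm, add_im, smul_im, smul_im, smul_eq_mul,
      smul_eq_mul]
    linear_combination (1 - L⁻¹) * hm + L⁻¹ * hn)
  have := norm_combo_lt_of_ne (axis.norm_eq (k := k) (2 * m)).le (axis.norm_eq (k := k) (2 * n)).le
    hne (a := 1 - L⁻¹) (b := L⁻¹) (sub_pos.2 (inv_lt_one_of_one_lt₀ hL)) (inv_pos.2 hL0) (by ring)
  rw [← e, hj, axis.norm_eq] at this
  exact lt_irrefl _ this

/-- The line is rotated about `0` from vertex to vertex. The nonpositive side of `K` for one rotated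
line is connected, since the line meets `K` in a single vertex. If the next rotated line separated
`1` from that vertex, it would meet this side, necessarily in its own vertex, which however lies on
the positive side. So the sign at `1` persists until it contradicts the one at `axis k 2`. -/
theorem not_separated_neighbours (hF : IsPolygonFractal k L K X) {c : ℂ}
    (hl : ∀ z ∈ K, (c * (z - 1)).im = 0 → z = 1) (h1 : (c * (axis k (-2) - 1)).im < 0)
    (h2 : 0 < (c * (axis k 2 - 1)).im) : False := by
  have hk := hF.three_le
  have hone : (1 : ℂ) ∈ K := by simpa using hF.vertex_mem 0
  set f : ℂ → ℝ := fun z => (c * (z - 1)).im with hf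
  have hf1 : f 1 = 0 := by simp [hf]
  have claim : ∀ i : ℕ, f (axis k (-(2 * ((i : ℤ) + 1)))) ≤ 0 := by
    intro i
    induction i with
    | zero => rw [Nat.cast_zero, zero_add, mul_one]; exact h1.le
    | succ i ih =>
      set g : ℂ → ℝ := fun z => f (axis k (-(2 * ((i : ℤ) + 1))) * z) with hg
      set g' : ℂ → ℝ := fun z => f (axis k (-(2 * ((i : ℤ) + 1 + 1))) * z) with hg'
      have hzero : ∀ n : ℤ, ∀ z ∈ K, f (axis k (-(2 * n)) * z) = 0 → z = axis k (2 * n) := by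
        intro n z hz h
        have := hl _ (by simpa using hF.rotate_mem (-n) hz) h
        rw [← one_mul z, ← axis.mul_neg_self (2 * n), mul_assoc, this, mul_one]
      have hD := hF.isPreconnected.inter_nonpos (f := g) (by rw [hg]; fun_prop)
        (hF.vertex_mem ((i : ℤ) + 1)) (by rw [hg]; simp only [axis.neg_mul_self]; exact hf1) (hzero _)
      by_contra hcon
      push Not at hcon
      have hone' : g' 1 = f (axis k (-(2 * ((i : ℤ) + 1 + 1)))) := by simp [hg']
      have hstep : g' (axis k (2 * ((i : ℤ) + 1))) < 0 := by
        simp only [hg']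
        rw [← axis.add, show -(2 * ((i : ℤ) + 1 + 1)) + 2 * (i + 1) = -2 by ring]
        exact h1
      have hmem : axis k (2 * ((i : ℤ) + 1)) ∈ K ∩ {z | g z ≤ 0} :=
        ⟨hF.vertex_mem _, by
          rw [Set.mem_ofPred_eq, hg]; simp only [axis.neg_mul_self]; exact hf1.le⟩
      have hmem1 : (1 : ℂ) ∈ K ∩ {z | g z ≤ 0} := ⟨hone, by simpa [hg] using ih⟩
      obtain ⟨z, ⟨hzK, hz⟩, hz0⟩ := hD.intermediate_value hmem hmem1
        (f := g') (by rw [hg']; fun_prop) ⟨hstep.le, by rw [hone']; push_cast at hcon; exact hcon.le⟩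
      have := hzero _ z hzK hz0
      rw [this] at hz
      simp only [hg, Set.mem_ofPred_eq] at hz
      rw [← axis.add, show -(2 * ((i : ℤ) + 1)) + 2 * (i + 1 + 1) = 2 by ring] at hz
      exact absurd h2 (not_lt.2 hz)
  have := claim (k - 2)
  have e : axis k (-(2 * (((k - 2 : ℕ) : ℤ) + 1))) = axis k 2 := by
    rw [← axis.add_period hF.ne_zero _ 1]
    congr 1
    push_cast [show 2 ≤ k by omega]
    ring
  rw [e] at this
  exact absurd h2 (not_lt.2 this)

/-- A line that meets the fractal only in vertices has all vertices on one side. -/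
theorem not_separated_of_line (hF : IsPolygonFractal k L K X) {c : ℂ} {t : ℝ}
    (hl : ∀ z ∈ K, (c * z).im + t = 0 → ∃ m : ℤ, z = axis k (2 * m)) {m n : ℤ}
    (hm : (c * axis k (2 * m)).im + t < 0) (hn : 0 < (c * axis k (2 * n)).im + t) : False := by
  have hk := hF.three_le
  -- By connectedness the line passes through a vertex of `K`, and through no other point of `K`;
  -- this vertex is rotated to `1`. If its neighbours lie on one side, all vertices do; otherwise
  -- `not_separated_neighbours` applies.
  obtain ⟨z, hzK, hz⟩ := hF.isPreconnected.intermediate_value (hF.vertex_mem m) (hF.vertex_mem n)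
    (f := fun z => (c * z).im + t) (by fun_prop) ⟨hm.le, hn.le⟩
  obtain ⟨a, rfl⟩ := hl z hzK hz
  replace hz : (c * axis k (2 * a)).im + t = 0 := hz
  have hf : ∀ z, (c * axis k (2 * a) * (z - 1)).im = (c * (axis k (2 * a) * z)).im + t := by
    intro z
    have : c * axis k (2 * a) * (z - 1) = c * (axis k (2 * a) * z) - c * axis k (2 * a) := by ring
    rw [this, sub_im]
    linear_combination -hz
  have hfv : ∀ j : ℤ, (c * axis k (2 * a) * (axis k (2 * (j - a)) - 1)).im =
      (c * axis k (2 * j)).im + t := by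
    intro j
    rw [hf, ← axis.add]; congr 4; ring
  have hone : ∀ z ∈ K, (c * axis k (2 * a) * (z - 1)).im = 0 → z = 1 := by
    intro z hzK hz0
    rw [hf] at hz0
    obtain ⟨j, hj⟩ := hl _ (hF.rotate_mem a hzK) hz0
    have := hF.vertex_unique_of_line hl (m := a) (n := j) hz (by rwa [hj] at hz0)
    rw [← hj] at this
    exact (mul_eq_left₀ (axis.ne_zero _)).1 this.symm
  have hne : ∀ j : ℤ, j = 1 ∨ j = -1 → (c * axis k (2 * a) * (axis k (2 * j) - 1)).im ≠ 0 := by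
    intro j hj h
    have h1 := hone _ (hF.vertex_mem j) h
    rw [axis.eq_one_iff hF.ne_zero, ZMod.intCast_zmod_eq_zero_iff_dvd] at h1
    have := Int.le_of_dvd one_pos (show (k : ℤ) ∣ 1 by rcases hj with rfl | rfl <;> simpa using h1)
    omega
  have h1 := hne 1 (.inl rfl)
  have h2 := hne (-1) (.inr rfl)
  rw [mul_one] at h1
  rw [show (2 : ℤ) * -1 = -2 by norm_num] at h2
  have hsign : ∀ c', (∀ z ∈ K, (c' * (z - 1)).im = 0 → z = 1) →
      (∃ j : ℤ, (c' * (axis k (2 * j) - 1)).im < 0) → 0 < (c' * (axis k 2 - 1)).im →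
      (c' * (axis k (-2) - 1)).im ≠ 0 → False := by
    rintro c' hc' ⟨j, hj⟩ h1 h2
    rcases h2.lt_or_gt with h2 | h2
    · exact hF.not_separated_neighbours hc' h2 h1
    · exact absurd (axis.im_mul_vertex_nonneg hk h1.le h2.le j) (not_le.2 hj)
  rcases h1.lt_or_gt with h1 | h1
  · refine hsign (-(c * axis k (2 * a))) (fun z hz h => hone z hz ?_) ⟨n - a, ?_⟩ ?_ ?_
    · rwa [neg_mul, neg_im, neg_eq_zero] at h
    · rw [neg_mul, neg_im, neg_lt_zero, hfv]; exact hn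
    · rw [neg_mul, neg_im]; linarith
    · rw [neg_mul, neg_im]; exact neg_ne_zero.2 h2
  · exact hsign _ hone ⟨m - a, by rw [hfv]; exact hm⟩ h1 h2

/-- A cell whose centre does not lie on an axis of symmetry lies on one side of this axis. -/
theorem im_vertex_nonneg (hF : IsPolygonFractal k L K X) {x : ℂ} (hx : x ∈ X) {h : ℤ}
    (hpos : 0 < (x * axis k (-h)).im) (m : ℤ) : 0 ≤ ((x + axis k (2 * m)) * axis k (-h)).im := by
  by_contra hneg
  push Not at hneg
  have e : ∀ z, (axis k (-h) * z).im + (x * axis k (-h)).im = ((x + z) * axis k (-h)).im := by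
    intro z
    rw [add_mul, add_im, mul_comm z, add_comm]
  have hmirror : ∀ w : ℂ, (w * axis k (-h)).im = 0 → axis k (2 * h) * (starRingEnd ℂ) w = w := by
    intro w hw
    have h1 := conj_eq_iff_im.2 hw
    rw [map_mul, axis.conj, neg_neg] at h1
    calc axis k (2 * h) * (starRingEnd ℂ) w
        = axis k h * ((starRingEnd ℂ) w * axis k h) := by rw [two_mul, axis.add]; ring
      _ = w := by rw [h1, mul_left_comm, axis.mul_neg_self, mul_one]
  -- The centre is the mean of the vertices, so some vertex lies strictly on its side.
  obtain ⟨n, hn⟩ : ∃ n : ℤ, 0 < ((x + axis k (2 * n)) * axis k (-h)).im := by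
    by_contra! hcon
    have hsum : ∑ n ∈ Finset.range k, ((x + axis k (2 * (n : ℤ))) * axis k (-h)).im =
        k * (x * axis k (-h)).im := by
      rw [← im_sum, ← Finset.sum_mul, Finset.sum_add_distrib,
        axis.sum_vertex (by have := hF.three_le; omega)]
      simp [mul_assoc]
    have hk : (0 : ℝ) < k := by exact_mod_cast hF.ne_zero.bot_lt
    have := Finset.sum_nonpos fun (n : ℕ) (_ : n ∈ Finset.range k) => hcon n
    rw [hsum] at this
    exact absurd (mul_pos hk hpos) (not_lt.2 this)
  -- The cell and its distinct mirror image share their points on the axis, which by nesting are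
  -- vertices.
  refine hF.not_separated_of_line (c := axis k (-h)) (t := (x * axis k (-h)).im) ?_
    (m := m) (n := n) (by rwa [e]) (by rwa [e])
  intro z hz hz0
  rw [e] at hz0
  refine hF.nesting x hx _ (hF.reflect_center_mem h x hx) ?_ z hz _ (hF.reflect_mem h z hz) ?_
  · intro hxx
    have h1 : (x * axis k (-h)).im = 0 := by
      rw [← conj_eq_iff_im, map_mul, axis.conj, neg_neg]
      conv_rhs => rw [hxx]
      rw [two_mul, axis.add]
      linear_combination (-(starRingEnd ℂ) x * axis k h) * axis.mul_neg_self (k := k) h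
    exact hpos.ne' h1
  · rw [← mul_add, ← map_add, hmirror _ hz0]

theorem im_vertex_nonpos (hF : IsPolygonFractal k L K X) {x : ℂ} (hx : x ∈ X) {h : ℤ}
    (hneg : (x * axis k (-h)).im < 0) (m : ℤ) : ((x + axis k (2 * m)) * axis k (-h)).im ≤ 0 := by
  have e : axis k (-(h - k)) = -axis k (-h) := by
    rw [show -(h - (k : ℤ)) = -h + k by ring, axis.add, axis.self hF.ne_zero, mul_neg_one]
  have := hF.im_vertex_nonneg hx (h := h - k) (by rw [e, mul_neg, neg_im]; linarith) m
  rw [e, mul_neg, neg_im] at this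
  linarith

/-- The relative position of two cells with a common vertex. -/
theorem exists_of_common_vertex (hF : IsPolygonFractal k L K X) {x y : ℂ} (hx : x ∈ X) (hy : y ∈ X)
    (hne : x ≠ y) {a b : ℤ} (hab : x + axis k (2 * a) = y + axis k (2 * b)) :
    ∃ d : ℤ, (b : ZMod k) = a + d ∧ 2 * (d - 1) < k ∧ k < 2 * (d + 1) := by
  have hk := hF.three_le
  have hk0 := hF.ne_zero
  have hkz : (k : ℤ) ≠ 0 := by exact_mod_cast hk0
  obtain ⟨d, hd0, hdk, hd⟩ : ∃ d : ℤ, 0 ≤ d ∧ d < k ∧ (b : ZMod k) = a + d :=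
    ⟨(b - a) % k, Int.emod_nonneg _ hkz, Int.emod_lt_of_pos _ (by omega), by simp⟩
  have hb : axis k (2 * b) = axis k (2 * (a + d)) :=
    axis.vertex_periodic hk0 _ _ (by rw [hd]; push_cast; ring)
  rw [hb] at hab
  have hd1 : 0 < d := by
    rcases hd0.eq_or_lt with h | h
    · exact absurd (by simpa [← h] using hab) hne
    · exact h
  refine ⟨d, hd, ?_⟩
  -- In coordinates around `x` this is the perpendicular bisector of `x` and `y`: it passes through
  -- the common vertex in the direction `axis k (2 * a + d)`. Reflection in it carries one cell to
  -- the other, so it meets the cell only in vertices.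
  set c := axis k (-(2 * a + d)) with hc
  set t := -(axis k (-d)).im with ht
  have hv : ∀ n : ℤ, (c * axis k (2 * (a + n))).im + t = ((axis k (2 * n) - 1) * axis k (-d)).im := by
    intro n
    rw [hc, ht, ← axis.add, sub_mul, one_mul, sub_im, ← axis.add, ← sub_eq_add_neg]
    congr 3; ring
  have hl : ∀ z ∈ K, (c * z).im + t = 0 → ∃ m : ℤ, z = axis k (2 * m) := by
    intro z hz hz0
    refine hF.nesting x hx y hy hne z hz _ (hF.reflect_mem (2 * a + d) z hz) ?_
    have h1 : (starRingEnd ℂ) (c * z - axis k (-d)) = c * z - axis k (-d) := by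
      rw [conj_eq_iff_im, sub_im]; linarith
    rw [map_sub, map_mul, axis.conj, axis.conj, neg_neg, neg_neg] at h1
    have h2 : axis k (2 * a + d) * c = 1 := axis.mul_neg_self _
    have h3 : axis k (2 * a + d) * axis k (-d) = axis k (2 * a) := by
      rw [← axis.add]; congr 1; ring
    have h4 : axis k (2 * a + d) * axis k d = axis k (2 * (a + d)) := by
      rw [← axis.add]; congr 1; ring
    have h5 : axis k (2 * (2 * a + d)) = axis k (2 * a + d) * axis k (2 * a + d) := by
      rw [← axis.add]; congr 1; ring
    rw [h5]
    linear_combination hab - axis k (2 * a + d) * h1 - z * h2 + h3 - h4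
  -- Signed distances of the two neighbours of the common vertex from the line. They cannot have
  -- opposite signs, which puts `π / 2` strictly between `(d - 1) π / k` and `(d + 1) π / k`.
  have s1 : ((axis k (2 * 1) - 1) * axis k (-d)).im =
      2 * Real.sin (Real.pi / k) * Real.cos ((d - 1) * (Real.pi / k)) := by
    rw [sub_mul, one_mul, sub_im, ← axis.add, axis.im_eq, axis.im_eq]
    have e1 : Real.pi * (2 * 1 + -d : ℤ) / k = Real.pi / k - (d - 1) * (Real.pi / k) := by
      push_cast; ring
    have e2 : Real.pi * (-d : ℤ) / k = -(Real.pi / k) - (d - 1) * (Real.pi / k) := by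
      push_cast; ring
    rw [e1, e2, Real.sin_sub, Real.sin_sub, Real.sin_neg, Real.cos_neg]; ring
  have s2 : ((axis k (2 * -1) - 1) * axis k (-d)).im =
      -(2 * Real.sin (Real.pi / k) * Real.cos ((d + 1) * (Real.pi / k))) := by
    rw [sub_mul, one_mul, sub_im, ← axis.add, axis.im_eq, axis.im_eq]
    have e1 : Real.pi * (2 * -1 + -d : ℤ) / k = -(Real.pi / k) - (d + 1) * (Real.pi / k) := by
      push_cast; ring
    have e2 : Real.pi * (-d : ℤ) / k = Real.pi / k - (d + 1) * (Real.pi / k) := by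
      push_cast; ring
    rw [e1, e2, Real.sin_sub, Real.sin_sub, Real.sin_neg, Real.cos_neg]; ring
  have hne0 : ∀ n : ℤ, n = 1 ∨ n = -1 → ((axis k (2 * n) - 1) * axis k (-d)).im ≠ 0 := by
    intro n hn h0
    have h1 := hF.vertex_unique_of_line hl (m := a + n) (n := a + 0)
      (by rw [hv, h0]) (by rw [hv]; simp)
    rw [axis.vertex_eq_iff hk0, Int.cast_add, Int.cast_add, add_right_inj, Int.cast_zero,
      ZMod.intCast_zmod_eq_zero_iff_dvd] at h1
    have := Int.le_of_dvd one_pos (show (k : ℤ) ∣ 1 by rcases hn with rfl | rfl <;> simpa using h1)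
    omega
  have hns : ∀ m n : ℤ, ((axis k (2 * m) - 1) * axis k (-d)).im < 0 →
      ¬ 0 < ((axis k (2 * n) - 1) * axis k (-d)).im := fun m n h1 h2 =>
    hF.not_separated_of_line hl (m := a + m) (n := a + n) (by rwa [hv]) (by rwa [hv])
  have n1 := hne0 1 (.inl rfl)
  have n2 := hne0 (-1) (.inr rfl)
  have m1 := hns 1 (-1)
  have m2 := hns (-1) 1
  rw [s1] at n1 m1 m2
  rw [s2] at n2 m1 m2
  have hk' : (3 : ℝ) ≤ k := by exact_mod_cast hk
  have hkp : (0 : ℝ) < k := by linarith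
  have hpi := Real.pi_pos
  have hdel : Real.pi / k ≤ Real.pi / 3 := by gcongr
  have hdel0 : 0 < Real.pi / k := by positivity
  have hkd : k * (Real.pi / k) = Real.pi := by field_simp
  have hsin : 0 < Real.sin (Real.pi / k) := Real.sin_pos_of_pos_of_lt_pi hdel0 (by linarith)
  have hd1' : (1 : ℝ) ≤ d := by exact_mod_cast hd1
  have hdk' : (d : ℝ) + 1 ≤ k := by exact_mod_cast hdk
  have hub : ((d : ℝ) + 1) * (Real.pi / k) ≤ Real.pi := by
    calc ((d : ℝ) + 1) * (Real.pi / k) ≤ k * (Real.pi / k) := by gcongr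
      _ = Real.pi := hkd
  have hlb : 0 ≤ ((d : ℝ) - 1) * (Real.pi / k) := mul_nonneg (by linarith) hdel0.le
  generalize Real.pi / k = δ at *
  have hexp : ((d : ℝ) + 1) * δ = (d - 1) * δ + 2 * δ := by ring
  constructor
  · by_contra hcon
    push Not at hcon
    have hcon' : (k : ℝ) ≤ 2 * (d - 1) := by exact_mod_cast hcon
    have b1 : Real.pi / 2 ≤ (d - 1) * δ := by nlinarith
    have c1 : Real.cos ((d - 1) * δ) ≤ 0 :=
      Real.cos_nonpos_of_pi_div_two_le_of_le b1 (by linarith)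
    have c2 : Real.cos ((d + 1) * δ) ≤ 0 :=
      Real.cos_nonpos_of_pi_div_two_le_of_le (by linarith) (by linarith)
    refine m1 (lt_of_le_of_ne ?_ n1) (lt_of_le_of_ne ?_ n2.symm)
    · exact mul_nonpos_of_nonneg_of_nonpos (by positivity) c1
    · exact neg_nonneg.2 (mul_nonpos_of_nonneg_of_nonpos (by positivity) c2)
  · by_contra hcon
    push Not at hcon
    have hcon' : 2 * ((d : ℝ) + 1) ≤ k := by exact_mod_cast hcon
    have b1 : (d + 1) * δ ≤ Real.pi / 2 := by nlinarith
    have c1 : 0 ≤ Real.cos ((d - 1) * δ) :=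
      Real.cos_nonneg_of_mem_Icc ⟨by linarith, by linarith⟩
    have c2 : 0 ≤ Real.cos ((d + 1) * δ) :=
      Real.cos_nonneg_of_mem_Icc ⟨by linarith, by linarith⟩
    refine m2 (lt_of_le_of_ne ?_ n2) (lt_of_le_of_ne ?_ n1.symm)
    · exact neg_nonpos.2 (by positivity)
    · positivity

/-- If `k = 5` or `k ≥ 7`, there is no cell around the centre of symmetry. -/
theorem zero_notMem (hF : IsPolygonFractal k L K X) (hk : k = 5 ∨ 7 ≤ k) : (0 : ℂ) ∉ X := by
  intro h0
  have hk0 := hF.ne_zero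
  obtain ⟨y, hy, hy0, a, b, hab⟩ : ∃ y ∈ X, y ≠ 0 ∧ ∃ a b : ℤ,
      axis k (2 * a) = y + axis k (2 * b) := by
    by_contra! hcon
    obtain ⟨x, hx, hx0⟩ := hF.exists_ne_zero
    refine hx0 (hF.isLinked (fun x => x = 0) ⟨0, h0, rfl⟩ ?_ x hx)
    rintro x hx y hy a b hab rfl
    by_contra hy0
    exact hcon y hy hy0 a b (by rwa [zero_add] at hab)
  obtain ⟨d, hd, hd1, hd2⟩ := hF.exists_of_common_vertex h0 hy hy0.symm
    (by rwa [zero_add] : 0 + axis k (2 * a) = y + axis k (2 * b))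
  have hb : axis k (2 * b) = axis k (2 * a) * axis k (2 * d) := by
    rw [axis.vertex_periodic hk0 b (a + d) (by rw [hd]; push_cast; ring), ← axis.add]; congr 1; ring
  -- A neighbour of the central cell, rotated so that the common vertex is `1`. An axis off its
  -- centre cuts it: axis `0` for odd `k`, and axis `1` for even `k`, as `sin 3x > 2 sin x` for `0 <
  -- x < π / 6`.
  have hmem : 1 - axis k (2 * d) ∈ X := by
    have := rotate_mem_of_reflect_mem hF.reflect_center_mem (-a) hy
    convert this using 1
    rw [show y = axis k (2 * a) * (1 - axis k (2 * d)) by rw [mul_sub, mul_one, ← hb, hab]; ring,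
      ← mul_assoc, mul_neg, axis.neg_mul_self, one_mul]
  have hpi := Real.pi_pos
  have hk5 : (5 : ℝ) ≤ k := by exact_mod_cast (show 5 ≤ k by omega)
  have hkp : (0 : ℝ) < k := by linarith
  have hdel0 : 0 < Real.pi / k := by positivity
  have hdel : Real.pi / k ≤ Real.pi / 5 := by gcongr
  have hsin : 0 < Real.sin (Real.pi / k) := Real.sin_pos_of_pos_of_lt_pi hdel0 (by linarith)
  have hcos : 1 / 2 < Real.cos (Real.pi / k) := by
    rw [← Real.cos_pi_div_three]
    exact Real.cos_lt_cos_of_nonneg_of_le_pi hdel0.le (by linarith) (by linarith)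
  have a1 : (axis k 1).im = Real.sin (Real.pi / k) := by rw [axis.im_eq]; simp
  have a2 : (axis k 2).im = 2 * Real.sin (Real.pi / k) * Real.cos (Real.pi / k) := by
    rw [axis.im_eq, ← Real.sin_two_mul]; congr 1; push_cast; ring
  have aneg : ∀ n : ℤ, (axis k (-n)).im = -(axis k n).im := fun n => by
    rw [← axis.conj, conj_im]
  obtain h | h | h : (k : ℤ) = 2 * d - 1 ∨ (k : ℤ) = 2 * d ∨ (k : ℤ) = 2 * d + 1 := by omega
  · have e : axis k (2 * d) = -axis k 1 := by
      rw [show 2 * d = (k : ℤ) + 1 by omega, axis.add, axis.self hk0, neg_one_mul]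
    rw [e, sub_neg_eq_add] at hmem
    have := hF.im_vertex_nonneg hmem (h := 0) (by simpa [a1] using hsin) (-1)
    rw [show (2 : ℤ) * -1 = -2 by norm_num, neg_zero, axis.zero, mul_one, add_im, add_im, one_im,
      aneg, a1, a2] at this
    nlinarith
  · rw [← h, axis.self hk0, sub_neg_eq_add] at hmem
    have hk7 : 7 ≤ k := by omega
    have hk7' : (7 : ℝ) ≤ k := by exact_mod_cast hk7
    have hdel7 : Real.pi / k ≤ Real.pi / 7 := by gcongr
    have hs6 : Real.sin (Real.pi / k) < 1 / 2 := by
      rw [← Real.sin_pi_div_six]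
      exact Real.sin_lt_sin_of_lt_of_le_pi_div_two (by linarith) (by linarith) (by linarith)
    have e1 : ((1 + 1 : ℂ) * axis k (-1)).im = -(2 * Real.sin (Real.pi / k)) := by
      rw [one_add_one_eq_two, ← ofReal_ofNat, im_ofReal_mul, aneg, a1]; ring
    have := hF.im_vertex_nonpos hmem (h := 1) (by rw [e1]; linarith) 2
    rw [add_mul, add_im, e1, ← axis.add, axis.im_eq,
      show Real.pi * (2 * 2 + -1 : ℤ) / k = 3 * (Real.pi / k) by push_cast; ring,
      Real.sin_three_mul] at this
    nlinarith [mul_pos hsin (sub_pos.2 hs6), mul_pos (mul_pos hsin hsin) (sub_pos.2 hs6)]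
  · have e : axis k (2 * d) = -axis k (-1) := by
      rw [show 2 * d = (k : ℤ) + -1 by omega, axis.add, axis.self hk0, neg_one_mul]
    rw [e, sub_neg_eq_add] at hmem
    have := hF.im_vertex_nonpos hmem (h := 0) (by simpa [a1, aneg] using hsin) 1
    rw [show (2 : ℤ) * 1 = 2 by norm_num, neg_zero, axis.zero, mul_one, add_im, add_im, one_im,
      aneg, a1, a2] at this
    nlinarith

end IsPolygonFractal

/-! ### Triangles and squares: potentials from a lattice -/

/-- If the differences between neighbouring centres lie in a lattice on which there is a suitable
homomorphism, then there is a consistent choice of rotations. -/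
theorem exists_isPotential_of_lattice {k : ℕ} {X : Set ℂ} (hX : IsLinked k X) {s ω : ℂ}
    (hs : s ≠ 0) (hω : ω.im ≠ 0) (e : ZMod k)
    (H : ∀ x ∈ X, ∀ y ∈ X, ∀ a b : ℤ, x + axis k (2 * a) = y + axis k (2 * b) →
      ∃ u v : ℤ, y - x = s * (u + v * ω) ∧ e * (u + v) = a - b) :
    ∃ j, IsPotential k X j := by
  rcases X.eq_empty_or_nonempty with rfl | ⟨x₀, hx₀⟩
  · exact ⟨0, fun x hx => hx.elim⟩
  have hlat : ∀ x : ℂ, ∃ u v : ℤ, x ∈ X → x - x₀ = s * (u + v * ω) := by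
    intro x
    by_cases hx : x ∈ X
    · obtain ⟨u, v, h⟩ := hX (fun x => ∃ u v : ℤ, x - x₀ = s * (u + v * ω))
        ⟨x₀, hx₀, 0, 0, by simp⟩ (by
          rintro x hx y hy a b hab ⟨u, v, huv⟩
          obtain ⟨u', v', h, -⟩ := H x hx y hy a b hab
          refine ⟨u + u', v + v', ?_⟩
          push_cast
          linear_combination huv + h) x hx
      exact ⟨u, v, fun _ => h⟩
    · exact ⟨0, 0, fun h => absurd h hx⟩
  choose U V hUV using hlat
  refine ⟨fun x => e * (U x + V x), fun x hx y hy a b hab => ?_⟩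
  obtain ⟨u, v, h, he⟩ := H x hx y hy a b hab
  -- Lattice coordinates are unique because `ω` is not real, so they add up along links.
  have h1 : ((U y - U x - u : ℤ) : ℂ) + ((V y - V x - v : ℤ) : ℂ) * ω = 0 := by
    refine (mul_eq_zero.1 (?_ : s * _ = 0)).resolve_left hs
    push_cast
    linear_combination h + hUV x hx - hUV y hy
  have h2 : V y - V x - v = 0 := by
    have := congrArg im h1
    rw [add_im, intCast_im, ← ofReal_intCast, im_ofReal_mul, zero_add, zero_im] at this
    exact_mod_cast (mul_eq_zero.1 this).resolve_right hω
  have h3 : U y - U x - u = 0 := by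
    rw [h2, Int.cast_zero, zero_mul, add_zero] at h1
    exact_mod_cast h1
  have e1 : (U y : ZMod k) = U x + u := by
    have : U y = U x + u := by omega
    rw [this]; push_cast; rfl
  have e2 : (V y : ZMod k) = V x + v := by
    have : V y = V x + v := by omega
    rw [this]; push_cast; rfl
  change (a : ZMod k) + e * (U x + V x) = b + e * (U y + V y)
  rw [e1, e2]
  linear_combination -he

namespace IsPolygonFractal

variable {k : ℕ} {L : ℝ} {K X : Set ℂ}

/-- Neighbouring centres differ by a difference of cube roots of unity, an element `(1 - ω)(u + v
ω)`, and `-(u + v)` recovers `a - b` modulo `3`. -/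
theorem exists_isPotential_of_three (hF : IsPolygonFractal 3 L K X) : ∃ j, IsPotential 3 X j := by
  set ω := axis 3 2 with hω
  have him : ω.im ≠ 0 := by
    rw [axis.im_eq]
    have hpi := Real.pi_pos
    refine (Real.sin_pos_of_pos_of_lt_pi (by positivity) ?_).ne'
    push_cast; linarith
  have h1 : (1 : ℂ) - ω ≠ 0 := by
    intro h
    apply him
    rw [← sub_eq_zero.1 h, one_im]
  have hsum : 1 + ω + ω ^ 2 = 0 := by
    have := axis.sum_vertex (k := 3) (by norm_num)
    simpa [Finset.sum_range_succ, axis.vertex_eq_pow, ← hω, show axis 3 4 = ω ^ 2 from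
      axis.vertex_eq_pow 2] using this
  have hred : ∀ a : ℤ, (axis 3 (2 * a) = 1 ∧ (a : ZMod 3) = 0) ∨
      (axis 3 (2 * a) = ω ∧ (a : ZMod 3) = 1) ∨ (axis 3 (2 * a) = ω ^ 2 ∧ (a : ZMod 3) = 2) := by
    intro a
    obtain ⟨j, hj0, hj3, hj⟩ := axis.exists_nat_lt (k := 3) (by norm_num) a
    have hz := (axis.vertex_eq_iff (by norm_num) _ _).1 hj
    rw [hj, hz]
    obtain rfl | rfl | rfl : j = 0 ∨ j = 1 ∨ j = 2 := by push_cast at hj3; omega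
    · exact .inl ⟨by simp, rfl⟩
    · exact .inr (.inl ⟨by simp [hω], rfl⟩)
    · exact .inr (.inr ⟨axis.vertex_eq_pow 2, rfl⟩)
  refine exists_isPotential_of_lattice hF.isLinked h1 him (-1) fun x hx y hy a b hab => ?_
  have hyx : y - x = axis 3 (2 * a) - axis 3 (2 * b) := by linear_combination -hab
  rw [hyx]
  rcases hred a with ⟨h, h'⟩ | ⟨h, h'⟩ | ⟨h, h'⟩ <;>
    rcases hred b with ⟨g, g'⟩ | ⟨g, g'⟩ | ⟨g, g'⟩ <;> rw [h, h', g, g']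
  · exact ⟨0, 0, by simp, by decide⟩
  · exact ⟨1, 0, by simp, by decide⟩
  · exact ⟨1, 1, by push_cast; ring, by decide⟩
  · exact ⟨-1, 0, by push_cast; ring, by decide⟩
  · exact ⟨0, 0, by simp, by decide⟩
  · exact ⟨0, 1, by push_cast; ring, by decide⟩
  · exact ⟨-1, -1, by push_cast; ring, by decide⟩
  · exact ⟨0, -1, by push_cast; ring, by decide⟩
  · exact ⟨0, 0, by simp, by decide⟩

/-- Neighbouring squares meet in opposite vertices (`d = 2`), so every link changes the rotation by
`2`, as in a chessboard colouring. -/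
theorem exists_isPotential_of_four (hF : IsPolygonFractal 4 L K X) : ∃ j, IsPotential 4 X j := by
  have hI : axis 4 2 = I := by
    rw [axis.eq_exp]
    convert exp_pi_div_two_mul_I using 3
    push_cast; ring
  refine exists_isPotential_of_lattice hF.isLinked (s := 2) (ω := I) two_ne_zero (by simp) 2
    fun x hx y hy a b hab => ?_
  by_cases hxy : x = y
  · subst hxy
    have := (axis.vertex_eq_iff (by norm_num) a b).1 (add_left_cancel hab)
    exact ⟨0, 0, by simp, by simp [this]⟩
  obtain ⟨d, hd, hd1, hd2⟩ := hF.exists_of_common_vertex hx hy hxy hab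
  obtain rfl : d = 2 := by push_cast at hd1 hd2; omega
  have hb : axis 4 (2 * b) = -axis 4 (2 * a) := by
    rw [axis.vertex_periodic (by norm_num) b (a + 2) (by rw [hd]; push_cast; ring), mul_add,
      axis.add, show (2 : ℤ) * 2 = (4 : ℕ) by norm_num, axis.self (by norm_num), mul_neg_one]
  have hyx : y - x = 2 * axis 4 (2 * a) := by linear_combination -hab - hb
  obtain ⟨j, hj0, hj4, hj⟩ := axis.exists_nat_lt (k := 4) (by norm_num) a
  have hab' : (a : ZMod 4) - b = 2 := by
    rw [hd, sub_add_cancel_left]; decide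
  rw [hyx, hab', hj]
  lift j to ℕ using hj0
  rw [axis.vertex_eq_pow, hI]
  have hj4' : j < 4 := by exact_mod_cast hj4
  interval_cases j
  · exact ⟨1, 0, by simp, by decide⟩
  · exact ⟨0, 1, by simp, by decide⟩
  · exact ⟨-1, 0, by simp, by decide⟩
  · exact ⟨0, -1, by simp, by decide⟩

/-- Axes off the centre do not cut the cell, so the nearest ones on both sides confine the direction
of each vertex. -/
theorem isChambered (hF : IsPolygonFractal k L K X) (h0 : (0 : ℂ) ∉ X) : IsChambered k X := by
  intro x hx m
  have hpi := Real.pi_pos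
  have hk3 : (3 : ℝ) ≤ k := by exact_mod_cast hF.three_le
  have hkp : (0 : ℝ) < k := by linarith
  set v := x + axis k (2 * m) with hv
  set δ := Real.pi / k with hδ
  have hδ0 : 0 < δ := by positivity
  have hδ3 : δ ≤ Real.pi / 3 := by rw [hδ]; gcongr
  set h : ℤ := ⌊arg x / δ⌋ with hh
  set α := arg x - h * δ with hα
  have hα0 : 0 ≤ α := by
    have := (le_div_iff₀ hδ0).1 (Int.floor_le (arg x / δ))
    rw [hα]; linarith
  have hα1 : α < δ := by
    have := (div_lt_iff₀ hδ0).1 (Int.lt_floor_add_one (arg x / δ))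
    rw [hα]; linarith
  obtain ⟨n, ⟨hn1, hn2⟩, -⟩ := existsUnique_sub_zsmul_mem_Ico (show 0 < 2 * Real.pi by positivity)
    (arg v - h * δ) (-Real.pi)
  set β := arg v - h * δ - n • (2 * Real.pi) with hβ
  have hxe : x = ‖x‖ * exp (((h * δ + α : ℝ) : ℂ) * I) := by
    rw [hα, add_sub_cancel]; exact (norm_mul_exp_arg_mul_I x).symm
  have hve : v = ‖v‖ * exp (((h * δ + β : ℝ) : ℂ) * I) := by
    conv_lhs => rw [← norm_mul_exp_arg_mul_I v]
    congr 1
    rw [exp_eq_exp_iff_exists_int]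
    refine ⟨n, ?_⟩
    rw [hβ, zsmul_eq_mul]; push_cast; ring
  have him : ∀ (r γ : ℝ) (g : ℤ), ((r : ℂ) * exp (((h * δ + γ : ℝ) : ℂ) * I) *
      axis k (-(h + g))).im = r * Real.sin (γ - g * δ) := by
    intro r γ g
    rw [axis.eq_exp, mul_assoc, ← exp_add, ← add_mul, ← ofReal_add, im_ofReal_mul,
      exp_ofReal_mul_I_im]
    congr 2
    rw [hδ]; push_cast; ring
  have hr : 0 < ‖x‖ := norm_pos_iff.2 fun h => h0 (h ▸ hx)
  have hpos : ∀ g : ℤ, 0 < Real.sin (α - g * δ) → 0 ≤ ‖v‖ * Real.sin (β - g * δ) := by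
    intro g hg
    have := hF.im_vertex_nonneg hx (h := h + g) (by rw [hxe, him]; positivity) m
    rwa [← hv, hve, him] at this
  have hneg : ∀ g : ℤ, Real.sin (α - g * δ) < 0 → ‖v‖ * Real.sin (β - g * δ) ≤ 0 := by
    intro g hg
    have := hF.im_vertex_nonpos hx (h := h + g)
      (by rw [hxe, him]; exact mul_neg_of_pos_of_neg hr hg) m
    rwa [← hv, hve, him] at this
  have hmem : ∀ (r γ : ℝ) (g : ℤ), 0 ≤ r → g * δ ≤ γ → γ ≤ (g + 1) * δ →
      (r : ℂ) * exp (((h * δ + γ : ℝ) : ℂ) * I) ∈ chamber k (h + g) := by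
    intro r γ g hr h1 h2
    refine ⟨r, hr, h * δ + γ, ⟨?_, ?_⟩, rfl⟩
    · rw [show Real.pi * ((h + g : ℤ) : ℝ) / k = (h + g) * δ by rw [hδ]; push_cast; ring]; linarith
    · rw [show Real.pi * (((h + g : ℤ) : ℝ) + 1) / k = (h + g + 1) * δ by
        rw [hδ]; push_cast; ring]
      linarith
  rcases (norm_nonneg v).eq_or_lt with hs | hs
  · rw [norm_eq_zero.1 hs.symm]
    obtain ⟨g, hg⟩ := chamber.exists_mem hF.ne_zero.bot_lt x
    exact ⟨g, hg, chamber.zero_mem g⟩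
  -- A centre on the axis `h` requires the axes `h - 1` and `h + 1`; the vertex then falls into one
  -- of the chambers `h - 1` and `h`, both of which contain the centre.
  rcases hα0.eq_or_lt with hα0 | hα0
  · have p := hpos (-1) (by
      rw [← hα0]
      exact Real.sin_pos_of_pos_of_lt_pi (by push_cast; linarith) (by push_cast; linarith))
    have q := hneg 1 (by
      rw [← hα0]
      exact Real.sin_neg_of_neg_of_neg_pi_lt (by push_cast; linarith) (by push_cast; linarith))
    replace p := nonneg_of_mul_nonneg_right p hs
    replace q := nonpos_of_mul_nonpos_right q hs
    have p' : -δ ≤ β := by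
      by_contra hcon
      push Not at hcon
      exact absurd (Real.sin_neg_of_neg_of_neg_pi_lt (by push_cast; linarith)
        (by push_cast; linarith)) (not_lt.2 p)
    have q' : β ≤ δ := by
      by_contra hcon
      push Not at hcon
      exact absurd (Real.sin_pos_of_pos_of_lt_pi (by push_cast; linarith)
        (by push_cast; linarith)) (not_lt.2 q)
    rcases le_total 0 β with hβ0 | hβ0
    · refine ⟨h + 0, ?_, ?_⟩
      · rw [hxe]; exact hmem _ _ _ hr.le (by push_cast; linarith) (by push_cast; linarith)
      · rw [hve]; exact hmem _ _ _ hs.le (by push_cast; linarith) (by push_cast; linarith)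
    · refine ⟨h + (-1), ?_, ?_⟩
      · rw [hxe]; exact hmem _ _ _ hr.le (by push_cast; linarith) (by push_cast; linarith)
      · rw [hve]; exact hmem _ _ _ hs.le (by push_cast; linarith) (by push_cast; linarith)
  · have p := hpos 0 (Real.sin_pos_of_pos_of_lt_pi (by push_cast; linarith) (by push_cast; linarith))
    have q := hneg 1 (Real.sin_neg_of_neg_of_neg_pi_lt (by push_cast; linarith)
      (by push_cast; linarith))
    replace p := nonneg_of_mul_nonneg_right p hs
    replace q := nonpos_of_mul_nonpos_right q hs
    push_cast at p q
    rw [zero_mul, sub_zero] at p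
    rw [one_mul] at q
    have p' : 0 ≤ β := by
      by_contra hcon
      push Not at hcon
      -- At `β = -π` the sine vanishes and only the other axis excludes the vertex.
      rcases hn1.eq_or_lt with h | h
      · rw [← h, ← Real.sin_add_two_pi] at q
        exact absurd (Real.sin_pos_of_pos_of_lt_pi (by linarith) (by linarith)) (not_lt.2 q)
      · exact absurd (Real.sin_neg_of_neg_of_neg_pi_lt hcon h) (not_lt.2 p)
    have q' : β ≤ δ := by
      by_contra hcon
      push Not at hcon
      exact absurd (Real.sin_pos_of_pos_of_lt_pi (by linarith) (by linarith)) (not_lt.2 q)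
    refine ⟨h + 0, ?_, ?_⟩
    · rw [hxe]; exact hmem _ _ _ hr.le (by push_cast; linarith) (by push_cast; linarith)
    · rw [hve]; exact hmem _ _ _ hs.le (by push_cast; linarith) (by push_cast; linarith)

/-- A consistent choice of rotations for the non-central cells in three consecutive chambers, the
second one of which begins at a vertex, can be extended to all cells. -/
theorem exists_isPotential (hF : IsPolygonFractal k L K X) (h6 : k = 6 → (0 : ℂ) ∉ X) (i : ℤ)
    {g : ℂ → ZMod k} (hg : IsPotential k
      (X \ {0} ∩ (chamber k (2 * i - 1) ∪ chamber k (2 * i) ∪ chamber k (2 * i + 1))) g) :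
    ∃ f, IsPotential k X f := by
  have hk := hF.three_le
  obtain rfl | rfl | hk' : k = 3 ∨ k = 4 ∨ (k = 6 ∨ k = 5 ∨ 7 ≤ k) := by omega
  · exact hF.exists_isPotential_of_three
  · exact hF.exists_isPotential_of_four
  -- Since `g` carries no information on a central cell, its absence is essential here.
  have h0 : (0 : ℂ) ∉ X := hk'.elim h6 hF.zero_notMem
  rw [Set.sdiff_singleton_eq_self h0] at hg
  refine exists_isPotential_of_chambers hk hF.reflect_center_mem hF.isLinked (hF.isChambered h0)
    ((hg.rotate i).mono fun x hx => ⟨rotate_mem_of_reflect_mem hF.reflect_center_mem i hx.1, ?_⟩)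
  rcases hx.2 with (h | h) | h
  · refine .inl (.inl ?_)
    have := chamber.rotate_mem (m := 2 * i) h
    rwa [show -1 + 2 * i = 2 * i - 1 by ring] at this
  · refine .inl (.inr ?_)
    have := chamber.rotate_mem (m := 2 * i) h
    rwa [zero_add] at this
  · refine .inr ?_
    have := chamber.rotate_mem (m := 2 * i) h
    rwa [add_comm] at this

end IsPolygonFractal

/-! ### Sets on the circle invariant under their own bisector reflections -/

/-- Two unit circles with three common points coincide. -/
theorem eq_zero_of_norm_sub_eq {s₁ s₂ s₃ t : ℂ} (h12 : s₁ ≠ s₂) (h13 : s₁ ≠ s₃) (h23 : s₂ ≠ s₃)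
    (hs : ∀ s, s = s₁ ∨ s = s₂ ∨ s = s₃ → ‖s‖ = 1 ∧ ‖s - t‖ = 1) : t = 0 := by
  have key : ∀ s, s = s₁ ∨ s = s₂ ∨ s = s₃ →
      s ^ 2 * (starRingEnd ℂ) t + t = t * (starRingEnd ℂ) t * s := by
    intro s h
    obtain ⟨h1, h2⟩ := hs s h
    have e1 := mul_conj' s
    have e2 := mul_conj' (s - t)
    rw [h1] at e1
    rw [h2, map_sub] at e2
    norm_num at e1 e2
    linear_combination (s - t) * e1 - s * e2
  have k1 := key s₁ (.inl rfl)
  have k2 := key s₂ (.inr (.inl rfl))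
  have k3 := key s₃ (.inr (.inr rfl))
  have a : (s₁ + s₂) * (starRingEnd ℂ) t = t * (starRingEnd ℂ) t := by
    refine mul_left_cancel₀ (sub_ne_zero.2 h12) ?_
    linear_combination k1 - k2
  have b : (s₁ + s₃) * (starRingEnd ℂ) t = t * (starRingEnd ℂ) t := by
    refine mul_left_cancel₀ (sub_ne_zero.2 h13) ?_
    linear_combination k1 - k3
  have c : (s₂ - s₃) * (starRingEnd ℂ) t = 0 := by linear_combination a - b
  exact (map_eq_zero _).1 ((mul_eq_zero.1 c).resolve_left (sub_ne_zero.2 h23))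

/-- If a set of at least three points on the unit circle is mapped into a translate of itself by the
reflection that exchanges two of its points, then it is mapped into itself. -/
theorem translation_eq_zero {U : Set ℂ} (hk : 3 ≤ U.ncard) (hU : ∀ u ∈ U, ‖u‖ = 1) {x y t : ℂ}
    (hx : x ∈ U) (hy : y ∈ U) (ht : ∀ u ∈ U, x * y * (starRingEnd ℂ) u - t ∈ U) : t = 0 := by
  obtain ⟨a, b, c, ha, hb, hc, hab, hac, hbc⟩ :=
    (Set.two_lt_ncard_iff (Set.finite_of_ncard_pos (by omega))).1 hk
  have hxy : x * y ≠ 0 := by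
    rw [← norm_ne_zero_iff, norm_mul, hU x hx, hU y hy]; norm_num
  have hinj : ∀ {u v : ℂ}, u ≠ v →
      x * y * (starRingEnd ℂ) u ≠ x * y * (starRingEnd ℂ) v := fun h h' =>
    h ((starRingEnd ℂ).injective (mul_left_cancel₀ hxy h'))
  have hn : ∀ u ∈ U, ‖x * y * (starRingEnd ℂ) u‖ = 1 ∧ ‖x * y * (starRingEnd ℂ) u - t‖ = 1 :=
    fun u hu => ⟨by simp [hU x hx, hU y hy, hU u hu], hU _ (ht u hu)⟩
  refine eq_zero_of_norm_sub_eq (hinj hab) (hinj hac) (hinj hbc) fun s h => ?_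
  rcases h with rfl | rfl | rfl
  exacts [hn a ha, hn b hb, hn c hc]

/-- A finite set on the unit circle which contains `1` and is mapped into itself by the reflections
that exchange two of its points is the set of the vertices of a regular polygon. -/
theorem eq_range_axis {U : Set ℂ} {k : ℕ} (hk : 3 ≤ k) (hUk : U.ncard = k)
    (hU : ∀ u ∈ U, ‖u‖ = 1) (h1 : (1 : ℂ) ∈ U)
    (H : ∀ x ∈ U, ∀ y ∈ U, x ≠ y → ∀ u ∈ U, x * y * (starRingEnd ℂ) u ∈ U) :
    U = Set.range fun m : ℤ => axis k (2 * m) := by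
  have hfin : U.Finite := Set.finite_of_ncard_pos (by omega)
  have hconj : ∀ u ∈ U, u * (starRingEnd ℂ) u = 1 := by
    intro u hu
    rw [mul_conj', hU u hu]; norm_num
  have hne : ∀ u ∈ U, u ≠ 0 := fun u hu h => by simpa [h] using hU u hu
  have hmul' : ∀ x ∈ U, ∀ y ∈ U, x ≠ y → x * y ∈ U := fun x hx y hy hxy => by
    simpa using H x hx y hy hxy 1 h1
  have hmul : ∀ x ∈ U, ∀ y ∈ U, x * y ∈ U := by
    intro x hx y hy
    by_cases hxy : x = y
    · subst hxy
      by_cases hx1 : x = 1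
      · subst hx1; simpa using h1
      obtain ⟨y, hy, hy1⟩ : ∃ y ∈ U, y ∉ ({1, x} : Set ℂ) := by
        by_contra! hcon
        have := (Set.ncard_le_ncard (show U ⊆ {1, x} from hcon)).trans (Set.ncard_insert_le 1 {x})
        rw [Set.ncard_singleton] at this
        omega
      simp only [Set.mem_insert_iff, Set.mem_singleton_iff, not_or] at hy1
      -- Reflections only give products of distinct elements directly; the square arises as `(x * y)
      -- * x` times the conjugate of `y`.
      have := H (x * y) (hmul' x hx y hy (Ne.symm hy1.2)) x hx
        (fun h => hy1.1 ((mul_eq_left₀ (hne x hx)).1 h)) y hy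
      rwa [show x * y * x * (starRingEnd ℂ) y = x * x * (y * (starRingEnd ℂ) y) by ring, hconj y hy,
        mul_one] at this
    · exact hmul' x hx y hy hxy
  have hpow : ∀ q ∈ U, q ^ k = 1 := by
    intro q hq
    -- Multiplication by `q` permutes `U`; comparing the products of all elements gives `q ^ k = 1`.
    set T := hfin.toFinset with hT
    have hcard : T.card = k := by rw [hT, ← Set.ncard_eq_toFinset_card U hfin, hUk]
    have himg : T.image (q * ·) = T := by
      refine Finset.eq_of_subset_of_card_le ?_ ?_
      · intro z hz
        obtain ⟨u, hu, rfl⟩ := Finset.mem_image.1 hz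
        exact hfin.mem_toFinset.2 (hmul q hq u (hfin.mem_toFinset.1 hu))
      · rw [Finset.card_image_of_injective _ (mul_right_injective₀ (hne q hq))]
    have hprod : ∏ u ∈ T, u = q ^ k * ∏ u ∈ T, u := by
      conv_lhs => rw [← himg, Finset.prod_image (mul_right_injective₀ (hne q hq)).injOn]
      rw [Finset.prod_mul_distrib, Finset.prod_const, hcard]
    have hp0 : ∏ u ∈ T, u ≠ 0 :=
      Finset.prod_ne_zero_iff.2 fun u hu => hne u (hfin.mem_toFinset.1 hu)
    exact (mul_eq_right₀ hp0).1 hprod.symm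
  have hprim := axis.isPrimitiveRoot (k := k) (by omega)
  set R : Finset ℂ := (Finset.range k).image fun n => axis k 2 ^ n with hR
  have hUR : U ⊆ R := by
    intro q hq
    have : NeZero k := ⟨by omega⟩
    obtain ⟨n, hn, h⟩ := hprim.eq_pow_of_pow_eq_one (hpow q hq)
    exact Finset.mem_coe.2 (Finset.mem_image.2 ⟨n, Finset.mem_range.2 hn, h⟩)
  have hURe : U = R := by
    refine Set.eq_of_subset_of_ncard_le hUR ?_ R.finite_toSet
    rw [Set.ncard_coe_finset, hUk]
    exact Finset.card_image_le.trans (by simp)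
  ext z
  constructor
  · intro hz
    obtain ⟨n, -, rfl⟩ := Finset.mem_image.1 (Finset.mem_coe.1 (hURe ▸ hz))
    exact ⟨n, axis.vertex_eq_pow n⟩
  · rintro ⟨m, rfl⟩
    obtain ⟨j, hj0, hjk, hj⟩ := axis.exists_nat_lt (show k ≠ 0 by omega) m
    lift j to ℕ using hj0
    rw [hURe, Finset.mem_coe, hR, Finset.mem_image]
    exact ⟨j, Finset.mem_range.2 (by exact_mod_cast hjk), by
      simp only [hj]; exact (axis.vertex_eq_pow j).symm⟩

/-! ### Normal form of a simple nested fractal -/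

namespace SimilitudeSystem

theorem bisectorReflection_eq {x y : ℂ} (hxy : x ≠ y) (z : ℂ) :
    bisectorReflection x y z = (x + y) / 2 -
      (y - x) / (starRingEnd ℂ) (y - x) * (starRingEnd ℂ) (z - (x + y) / 2) := by
  have : Nonempty (AffineSubspace.perpBisector x y) :=
    ⟨⟨midpoint ℝ x y, AffineSubspace.midpoint_mem_perpBisector x y⟩⟩
  have hd : y - x ≠ 0 := sub_ne_zero.2 hxy.symm
  have hd' : (starRingEnd ℂ) (y - x) ≠ 0 := (map_ne_zero _).2 hd
  have hm : midpoint ℝ x y = (x + y) / 2 := by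
    rw [midpoint_eq_smul_add, real_smul]; norm_num; ring
  set m := (x + y) / 2 with hmdef
  -- The coefficient of the orthogonal projection of `z - m` onto `y - x`.
  set t : ℝ := ((z - m) * (starRingEnd ℂ) (y - x)).re / normSq (y - x) with ht
  have htc : 2 * (t : ℂ) * (y - x) = (z - m) +
      (y - x) / (starRingEnd ℂ) (y - x) * (starRingEnd ℂ) (z - m) := by
    have e : (t : ℂ) = ((z - m) * (starRingEnd ℂ) (y - x) +
        (starRingEnd ℂ) (z - m) * (y - x)) / 2 / ((y - x) * (starRingEnd ℂ) (y - x)) := by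
      rw [mul_conj, ht, ofReal_div, re_eq_add_conj]
      simp only [map_mul, conj_conj]
    rw [e]
    field_simp
  have hnsq : normSq (y - x) ≠ 0 := fun h => hd (normSq_eq_zero.1 h)
  have hp : z - t * (y - x) ∈ AffineSubspace.perpBisector x y := by
    have h1 : (starRingEnd ℂ) (z - t * (y - x) - m) * (y - x) =
        (starRingEnd ℂ) ((z - m) * (starRingEnd ℂ) (y - x)) - ((t * normSq (y - x) : ℝ) : ℂ) := by
      push_cast
      rw [← mul_conj]
      simp only [map_sub, map_mul, conj_ofReal, conj_conj]
      ring
    have h2 : t * normSq (y - x) = ((z - m) * (starRingEnd ℂ) (y - x)).re := by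
      rw [ht]; field_simp
    rw [AffineSubspace.mem_perpBisector_iff_inner_eq_zero, hm, vsub_eq_sub, vsub_eq_sub,
      Complex.inner, mul_comm (y - x), h1, sub_re, conj_re, ofReal_re, h2, sub_self]
  have hv : (t * (y - x) : ℂ) ∈ (AffineSubspace.perpBisector x y).directionᗮ := by
    rw [AffineSubspace.direction_perpBisector, Submodule.orthogonal_orthogonal]
    rw [← real_smul]
    exact Submodule.smul_mem _ _ (Submodule.mem_span_singleton_self _)
  have := EuclideanGeometry.reflection_orthogonal_vadd hp hv
  rw [vadd_eq_add, vadd_eq_add, add_sub_cancel] at this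
  rw [bisectorReflection, this]
  linear_combination -htc

variable (S : SimilitudeSystem)

theorem L_pos : 0 < S.L := lt_trans one_pos S.one_lt_L

theorem L_ne_zero : (S.L : ℂ) ≠ 0 := by exact_mod_cast S.L_pos.ne'

theorem finite_innerVertices : S.innerVertices.Finite :=
  Set.finite_iUnion fun _ => S.finite_essential.image _

/-- The essential fixed points lie on a circle around the centroid of the inner vertices. -/
theorem exists_center (hS : S.IsSimpleNestedFractal) : ∃ c : ℂ, ∃ ρ : ℝ, 0 < ρ ∧
    (∀ x ∈ S.essential, ‖x - c‖ = ρ) ∧ ∀ x ∈ S.essential, ∀ y ∈ S.essential, x ≠ y →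
      ∀ z, bisectorReflection x y z = c + (x - c) * (y - c) / ρ ^ 2 * (starRingEnd ℂ) (z - c) := by
  set T := S.finite_innerVertices.toFinset with hT
  obtain ⟨x₀, hx₀, y₀, hy₀, hne₀⟩ := (Set.one_lt_ncard S.finite_essential).1 hS.two_le
  have hTpos : (T.card : ℂ) ≠ 0 := by
    have : T.Nonempty := ⟨S.Ψ ⟨0, S.N_pos⟩ x₀, S.finite_innerVertices.mem_toFinset.2
      (Set.mem_iUnion.2 ⟨_, x₀, hx₀, rfl⟩)⟩
    exact_mod_cast this.card_pos.ne'
  set c : ℂ := (∑ v ∈ T, v) / T.card with hc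
  have hsum : ∑ v ∈ T, v = T.card * c := by rw [hc]; field_simp
  -- Every reflection permutes the inner vertices, hence fixes their centroid.
  have hfix : ∀ x ∈ S.essential, ∀ y ∈ S.essential, x ≠ y → bisectorReflection x y c = c := by
    intro x hx y hy hxy
    have hd : y - x ≠ 0 := sub_ne_zero.2 hxy.symm
    have hB : (y - x) / (starRingEnd ℂ) (y - x) ≠ 0 := div_ne_zero hd ((map_ne_zero _).2 hd)
    have hinj : Function.Injective (bisectorReflection x y) := by
      intro a b hab
      rw [bisectorReflection_eq hxy, bisectorReflection_eq hxy] at hab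
      exact sub_left_injective ((starRingEnd ℂ).injective
        (mul_left_cancel₀ hB (sub_right_injective hab)))
    have himg : T.image (bisectorReflection x y) = T := by
      refine Finset.eq_of_subset_of_card_le ?_ (Finset.card_image_of_injective _ hinj).ge
      intro z hz
      obtain ⟨v, hv, rfl⟩ := Finset.mem_image.1 hz
      obtain ⟨i, hi⟩ := Set.mem_iUnion.1 (S.finite_innerVertices.mem_toFinset.1 hv)
      obtain ⟨j, hj⟩ := hS.symmetry i x hx y hy hxy
      exact S.finite_innerVertices.mem_toFinset.2
        (Set.mem_iUnion.2 ⟨j, hj ▸ Set.mem_image_of_mem _ hi⟩)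
    have h1 : ∑ v ∈ T, bisectorReflection x y v = ∑ v ∈ T, v := by
      conv_rhs => rw [← himg, Finset.sum_image hinj.injOn]
    simp_rw [bisectorReflection_eq hxy] at h1
    rw [Finset.sum_sub_distrib, ← Finset.mul_sum, ← map_sum, Finset.sum_sub_distrib, hsum] at h1
    simp only [Finset.sum_const, nsmul_eq_mul, map_sub, map_mul, map_natCast] at h1
    rw [bisectorReflection_eq hxy]
    refine mul_left_cancel₀ hTpos ?_
    rw [← h1]
    simp only [map_sub]
    ring
  have hswap : ∀ x y : ℂ, x ≠ y → bisectorReflection x y x = y := by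
    intro x y hxy
    have hd' : (starRingEnd ℂ) (y - x) ≠ 0 := (map_ne_zero _).2 (sub_ne_zero.2 hxy.symm)
    rw [bisectorReflection_eq hxy, show x - (x + y) / 2 = -(1 / 2) * (y - x) by ring, map_mul]
    simp only [map_neg, map_div₀, map_one, map_ofNat]
    field_simp
    ring
  have hdiff : ∀ x ∈ S.essential, ∀ y ∈ S.essential, x ≠ y → ∀ z,
      bisectorReflection x y z - c = -((y - x) / (starRingEnd ℂ) (y - x) *
        (starRingEnd ℂ) (z - c)) := by
    intro x hx y hy hxy z
    conv_lhs => rw [← hfix x hx y hy hxy]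
    rw [bisectorReflection_eq hxy, bisectorReflection_eq hxy]
    simp only [map_sub]
    ring
  have hnorm : ∀ x ∈ S.essential, ‖x - c‖ = ‖x₀ - c‖ := by
    intro x hx
    by_cases hxx : x₀ = x
    · rw [hxx]
    have h := hdiff x₀ hx₀ x hx hxx x₀
    rw [hswap x₀ x hxx] at h
    have hn : ‖x - x₀‖ ≠ 0 := norm_ne_zero_iff.2 (sub_ne_zero.2 (Ne.symm hxx))
    rw [h, norm_neg, norm_mul, norm_div, RCLike.norm_conj, RCLike.norm_conj, div_self hn, one_mul]
  have hρ : 0 < ‖x₀ - c‖ := by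
    refine norm_pos_iff.2 fun h => hne₀ ?_
    have := hnorm y₀ hy₀
    rw [h, norm_zero, norm_eq_zero] at this
    rw [sub_eq_zero.1 h, sub_eq_zero.1 this]
  refine ⟨c, ‖x₀ - c‖, hρ, hnorm, fun x hx y hy hxy z => ?_⟩
  have h := hdiff x hx y hy hxy x
  rw [hswap x y hxy] at h
  have hm := mul_conj' (x - c)
  rw [hnorm x hx] at hm
  have hρ' : ((‖x₀ - c‖ : ℝ) : ℂ) ^ 2 ≠ 0 := by
    exact_mod_cast pow_ne_zero 2 hρ.ne'
  have e : (x - c) * (y - c) / ((‖x₀ - c‖ : ℝ) : ℂ) ^ 2 =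
      -((y - x) / (starRingEnd ℂ) (y - x)) := by
    rw [div_eq_iff hρ', ← hm, h]
    ring
  rw [← sub_eq_iff_eq_add', hdiff x hx y hy hxy, e]
  ring

/-- The centre of the cell with index `i`, in the coordinate `u` with `z = b + p u` on the scale of
the cells. -/
noncomputable def cellCenter (b p : ℂ) (i : Fin S.N) : ℂ := (b + S.L * S.ν i - S.L * b) / p

theorem Ψ_eq {b p : ℂ} (hp : p ≠ 0) (i : Fin S.N) (u : ℂ) :
    S.Ψ i (b + p * u) = b + p / S.L * (S.cellCenter b p i + u) := by
  have hL := S.L_ne_zero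
  rw [Ψ, cellCenter]
  field_simp
  ring

/-- In the coordinate `u` with `z = b + p u`, the essential fixed points are the vertices of the
standard regular polygon, and the cells are permuted by its reflections. -/
structure IsNormalization (b p : ℂ) : Prop where
  ne_zero : p ≠ 0
  mem_essential : ∀ z, z ∈ S.essential ↔ ∃ m : ℤ, z = b + p * axis S.k (2 * m)
  reflect : ∀ (h : ℤ) (i : Fin S.N), ∃ j, S.cellCenter b p j =
    axis S.k (2 * h) * (starRingEnd ℂ) (S.cellCenter b p i)

/-- The symmetry axiom says only that the vertex sets of cells are permuted, so the reflected
polygon fits the original up to a translation `t`. Three points on a circle force `t = 0`: centres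
go to centres, and the polygon is invariant under its own reflections, hence regular. -/
theorem exists_isNormalization (hS : S.IsSimpleNestedFractal) (hk : 3 ≤ S.k) {v : ℂ}
    (hv : v ∈ S.essential) : ∃ b p : ℂ, S.IsNormalization b p ∧ v = b + p := by
  obtain ⟨b, ρ, hρ, hnorm, hrefl⟩ := S.exists_center hS
  set p := v - b with hpdef
  have hpn : ‖p‖ = ρ := hnorm v hv
  have hp : p ≠ 0 := norm_ne_zero_iff.1 (hpn.symm ▸ hρ.ne')
  have hk0 : S.k ≠ 0 := by omega
  have hpp : p * (starRingEnd ℂ) p = (ρ : ℂ) ^ 2 := by rw [mul_conj', hpn]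
  have hρ2 : (ρ : ℂ) ^ 2 ≠ 0 := by exact_mod_cast pow_ne_zero 2 hρ.ne'
  set U : Set ℂ := {u | b + p * u ∈ S.essential} with hU
  have hVU : S.essential = (fun u => b + p * u) '' U := by
    ext z
    refine ⟨fun hz => ⟨(z - b) / p, ?_, ?_⟩, ?_⟩
    · rw [hU, Set.mem_ofPred_eq, mul_div_cancel₀ _ hp, add_sub_cancel]; exact hz
    · simp only [mul_div_cancel₀ _ hp, add_sub_cancel]
    · rintro ⟨u, hu, rfl⟩; exact hu
  have hinj : Function.Injective fun u => b + p * u := fun u u' h =>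
    mul_left_cancel₀ hp (add_left_cancel h)
  have hcard : U.ncard = S.k := by
    rw [k, hVU, Set.ncard_image_of_injective _ hinj]
  have hU1 : ∀ u ∈ U, ‖u‖ = 1 := by
    intro u hu
    have := hnorm _ hu
    rw [add_sub_cancel_left, norm_mul, hpn] at this
    exact (mul_eq_left₀ hρ.ne').1 this
  have h1 : (1 : ℂ) ∈ U := by
    rw [hU, Set.mem_ofPred_eq, hpdef]; simpa using hv
  have hσ : ∀ x ∈ U, ∀ y ∈ U, x ≠ y → ∀ u,
      bisectorReflection (b + p * x) (b + p * y) (b + p * u) =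
        b + p * (x * y * (starRingEnd ℂ) u) := by
    intro x hx y hy hxy u
    rw [hrefl _ hx _ hy (hinj.ne hxy), add_sub_cancel_left, add_sub_cancel_left,
      add_sub_cancel_left, map_mul, ← hpp]
    have hp' : (starRingEnd ℂ) p ≠ 0 := (map_ne_zero _).2 hp
    field_simp
  have hpL : p / S.L ≠ 0 := div_ne_zero hp S.L_ne_zero
  have key : ∀ (i : Fin S.N), ∀ x ∈ U, ∀ y ∈ U, x ≠ y → ∃ j, S.cellCenter b p j =
      x * y * (starRingEnd ℂ) (S.cellCenter b p i) ∧ ∀ u ∈ U, x * y * (starRingEnd ℂ) u ∈ U := by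
    intro i x hx y hy hxy
    obtain ⟨j, hj⟩ := hS.symmetry i _ hx _ hy (hinj.ne hxy)
    set t := S.cellCenter b p j - x * y * (starRingEnd ℂ) (S.cellCenter b p i) with ht
    have hmem : ∀ u ∈ U, x * y * (starRingEnd ℂ) u - t ∈ U := by
      intro u hu
      have h2 : bisectorReflection (b + p * x) (b + p * y) (S.Ψ i (b + p * u)) ∈
          S.Ψ j '' S.essential := hj ▸ Set.mem_image_of_mem _ (Set.mem_image_of_mem _ hu)
      obtain ⟨z, hz, hzz⟩ := h2
      rw [hVU] at hz
      obtain ⟨u', hu', rfl⟩ := hz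
      rw [S.Ψ_eq hp, S.Ψ_eq hp, show b + p / S.L * (S.cellCenter b p i + u) =
        b + p * ((S.cellCenter b p i + u) / S.L) by ring, hσ x hx y hy hxy, map_div₀, conj_ofReal,
        show b + p * (x * y * ((starRingEnd ℂ) (S.cellCenter b p i + u) / S.L)) =
        b + p / S.L * (x * y * (starRingEnd ℂ) (S.cellCenter b p i + u)) by ring, map_add] at hzz
      have h3 := mul_left_cancel₀ hpL (add_left_cancel hzz)
      convert hu' using 1
      rw [ht]
      linear_combination -h3
    have ht0 : t = 0 := translation_eq_zero (by omega) hU1 hx hy hmem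
    refine ⟨j, sub_eq_zero.1 ht0, fun u hu => ?_⟩
    simpa [ht0] using hmem u hu
  have hUr : U = Set.range fun m : ℤ => axis S.k (2 * m) :=
    eq_range_axis hk hcard hU1 h1 fun x hx y hy hxy =>
      (key ⟨0, S.N_pos⟩ x hx y hy hxy).choose_spec.2
  have hUm : ∀ m : ℤ, axis S.k (2 * m) ∈ U := fun m => hUr ▸ ⟨m, rfl⟩
  refine ⟨b, p, ⟨hp, fun z => ?_, fun h i => ?_⟩, by rw [hpdef, add_sub_cancel]⟩
  · rw [hVU, hUr]
    constructor
    · rintro ⟨_, ⟨m, rfl⟩, rfl⟩; exact ⟨m, rfl⟩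
    · rintro ⟨m, rfl⟩; exact ⟨_, ⟨m, rfl⟩, rfl⟩
  · by_cases hh : axis S.k (2 * h) = 1
    · have hne : axis S.k (2 * 1) ≠ axis S.k (2 * -1) := by
        intro h
        rw [axis.vertex_eq_iff hk0, ← sub_eq_zero, ← Int.cast_sub,
          ZMod.intCast_zmod_eq_zero_iff_dvd] at h
        have := Int.le_of_dvd two_pos (by simpa using h)
        omega
      obtain ⟨j, hj, -⟩ := key i _ (hUm 1) _ (hUm (-1)) hne
      refine ⟨j, ?_⟩
      rw [hj, hh, ← axis.add]
      simp
    · obtain ⟨j, hj, -⟩ := key i _ (hUm h) _ h1 hh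
      exact ⟨j, by rw [hj, mul_one]⟩

theorem Ψ_injective (i : Fin S.N) : Function.Injective (S.Ψ i) := by
  intro x y h
  rw [Ψ, Ψ] at h
  exact (div_left_inj' S.L_ne_zero).1 (add_right_cancel h)

theorem dist_Ψ (i : Fin S.N) (x y : ℂ) : dist (S.Ψ i x) (S.Ψ i y) = dist x y / S.L := by
  rw [Ψ, Ψ, dist_add_right, dist_eq_norm, dist_eq_norm, ← sub_div, norm_div, norm_real,
    Real.norm_of_nonneg S.L_pos.le]

theorem isCompact_fractal : IsCompact S.fractal := S.fractal_spec.2.1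

theorem Ψ_mem_fractal (i : Fin S.N) {z : ℂ} (hz : z ∈ S.fractal) : S.Ψ i z ∈ S.fractal := by
  rw [S.fractal_spec.2.2]
  exact Set.mem_iUnion.2 ⟨i, z, hz, rfl⟩

theorem exists_Ψ_eq_of_mem_fractal {z : ℂ} (hz : z ∈ S.fractal) :
    ∃ i, ∃ z' ∈ S.fractal, S.Ψ i z' = z := by
  rw [S.fractal_spec.2.2] at hz
  exact Set.mem_iUnion.1 hz

/-- The map divides the distance to the nearest point of the fractal by `L` while fixing `x`, so
this distance is zero. -/
theorem mem_fractal_of_fixed {i : Fin S.N} {x : ℂ} (hx : S.Ψ i x = x) : x ∈ S.fractal := by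
  obtain ⟨y, hy, hxy⟩ := S.isCompact_fractal.exists_infDist_eq_dist S.fractal_spec.1 x
  have h1 : dist x y ≤ dist x y / S.L := by
    rw [← hxy, hxy, ← S.dist_Ψ i, hx, ← hxy]
    exact Metric.infDist_le_dist_of_mem (S.Ψ_mem_fractal i hy)
  have h2 : dist x y ≤ 0 := by
    by_contra hcon
    push Not at hcon
    exact absurd h1 (not_le.2 (div_lt_self hcon S.one_lt_L))
  rwa [dist_le_zero.1 h2]

theorem essential_subset_fractal : S.essential ⊆ S.fractal := by
  rintro x ⟨⟨i, hi⟩, -⟩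
  exact S.mem_fractal_of_fixed hi

theorem essential_nonempty (hS : S.IsSimpleNestedFractal) : S.essential.Nonempty :=
  Set.nonempty_of_ncard_ne_zero (by have : 2 ≤ S.essential.ncard := hS.two_le; omega)

/-- A property that passes between cells with a common vertex holds for all cells if it holds for
one of them. -/
theorem forall_index (hS : S.IsSimpleNestedFractal) {P : Fin S.N → Prop} {a₀ : Fin S.N}
    (h₀ : P a₀)
    (step : ∀ a b, (S.Ψ a '' S.essential ∩ S.Ψ b '' S.essential).Nonempty → P a → P b)
    (a : Fin S.N) : P a := by
  have hvert : ∀ v ∈ S.innerVertices, ∀ i, v ∈ S.Ψ i '' S.fractal → v ∈ S.Ψ i '' S.essential := by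
    intro v hv i hi
    obtain ⟨a, ha⟩ := Set.mem_iUnion.1 hv
    by_cases hai : a = i
    · exact hai ▸ ha
    · have := (hS.nesting a i hai).subset ⟨Set.image_mono S.essential_subset_fractal ha, hi⟩
      exact this.2
  have hprop : ∀ v w : S.innerVertices, S.innerGraph.Reachable v w →
      (∀ a, (v : ℂ) ∈ S.Ψ a '' S.essential → P a) → ∀ a, (w : ℂ) ∈ S.Ψ a '' S.essential → P a := by
    rintro v w ⟨p⟩
    induction p with
    | nil => exact id
    | cons hadj p ih =>
      intro hv
      refine ih fun a ha => ?_
      obtain ⟨-, i, h1, h2⟩ := hadj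
      exact step i a ⟨_, hvert _ (Subtype.coe_prop _) i h2, ha⟩
        (hv i (hvert _ (Subtype.coe_prop _) i h1))
  obtain ⟨x, hx⟩ := S.essential_nonempty hS
  have hmem : ∀ i, S.Ψ i x ∈ S.innerVertices := fun i => Set.mem_iUnion.2 ⟨i, x, hx, rfl⟩
  exact hprop ⟨_, hmem a₀⟩ ⟨_, hmem a⟩ (hS.connected.preconnected _ _)
    (fun b hb => step a₀ b ⟨_, ⟨x, hx, rfl⟩, hb⟩ h₀) a ⟨x, hx, rfl⟩

/-- By induction on `n`, any two points are joined by a chain with jumps at most `D / L ^ n`: scaled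
chains run inside the cells, and cells are joined through common vertices. The two compact parts of
a separation would have positive distance. -/
theorem isPreconnected_fractal (hS : S.IsSimpleNestedFractal) : IsPreconnected S.fractal := by
  set D := Metric.diam S.fractal with hD
  have hL := S.L_pos
  have chain : ∀ (n : ℕ) (Q : ℂ → Prop),
      (∀ z ∈ S.fractal, ∀ z' ∈ S.fractal, dist z z' ≤ D / S.L ^ n → Q z → Q z') →
      ∀ z ∈ S.fractal, ∀ z' ∈ S.fractal, Q z → Q z' := by
    intro n
    induction n with
    | zero =>
      intro Q hQ z hz z' hz'
      refine hQ z hz z' hz' ?_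
      rw [pow_zero, div_one]
      exact Metric.dist_le_diam_of_mem S.isCompact_fractal.isBounded hz hz'
    | succ n ih =>
      intro Q hQ
      have hcell : ∀ i, ∀ z ∈ S.fractal, ∀ z' ∈ S.fractal, Q (S.Ψ i z) → Q (S.Ψ i z') := by
        intro i
        refine ih (fun z => Q (S.Ψ i z)) fun z hz z' hz' hd => ?_
        refine hQ _ (S.Ψ_mem_fractal i hz) _ (S.Ψ_mem_fractal i hz') ?_
        rw [dist_Ψ, pow_succ, ← div_div]
        gcongr
      intro z hz z' hz' hQz
      obtain ⟨i, y, hy, rfl⟩ := S.exists_Ψ_eq_of_mem_fractal hz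
      obtain ⟨i', y', hy', rfl⟩ := S.exists_Ψ_eq_of_mem_fractal hz'
      refine S.forall_index hS (P := fun a => ∀ u ∈ S.fractal, Q (S.Ψ a u)) (a₀ := i)
        (fun u hu => hcell i y hy u hu hQz) ?_ i' y' hy'
      rintro a b ⟨-, ⟨s, hs, rfl⟩, ⟨t, ht, hst⟩⟩ hP u hu
      refine hcell b t (S.essential_subset_fractal ht) u hu ?_
      rw [hst]
      exact hP s (S.essential_subset_fractal hs)
  refine isPreconnected_closed_iff.2 fun t t' ht ht' hsub ⟨q, hq, hqt⟩ ⟨q', hq', hqt'⟩ => ?_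
  by_contra hemp
  have hdisj : Disjoint (S.fractal ∩ t) (S.fractal ∩ t') :=
    Set.disjoint_left.2 fun z h h' => hemp ⟨z, h.1, h.2, h'.2⟩
  obtain ⟨δ, hδ, hthick⟩ := hdisj.exists_thickenings (S.isCompact_fractal.inter_right ht)
    (S.isCompact_fractal.isClosed.inter ht')
  obtain ⟨n, hn⟩ : ∃ n : ℕ, D / S.L ^ n < δ := by
    have h := (tendsto_const_nhds (x := D)).div_atTop (tendsto_pow_atTop_atTop_of_one_lt S.one_lt_L)
    exact ((h.eventually (gt_mem_nhds hδ))).exists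
  have := chain n (· ∈ t) (fun z hz z' hz' hd hzt => by
    by_contra hzt'
    have h1 : z' ∈ S.fractal ∩ t' := ⟨hz', (hsub hz').resolve_left hzt'⟩
    have h2 : z' ∈ Metric.thickening δ (S.fractal ∩ t) :=
      Metric.mem_thickening_iff.2 ⟨z, ⟨hz, hzt⟩, by rw [dist_comm]; linarith⟩
    exact Set.disjoint_left.1 hthick h2 (Metric.self_subset_thickening hδ _ h1)) q hq q' hq' hqt
  exact hemp ⟨q', hq', this, hqt'⟩

namespace IsNormalization

variable {S} {b p : ℂ}

theorem vertex_mem_essential (hN : S.IsNormalization b p) (m : ℤ) :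
    b + p * axis S.k (2 * m) ∈ S.essential := (hN.mem_essential _).2 ⟨m, rfl⟩

theorem Ψ_eq_Ψ_iff (hN : S.IsNormalization b p) (i j : Fin S.N) (u v : ℂ) :
    S.Ψ i (b + p * u) = S.Ψ j (b + p * v) ↔
      S.cellCenter b p i + u = S.cellCenter b p j + v := by
  rw [S.Ψ_eq hN.ne_zero, S.Ψ_eq hN.ne_zero, add_right_inj,
    mul_right_inj' (div_ne_zero hN.ne_zero S.L_ne_zero)]

/-- The reflection permutes the cells, so the reflected fractal solves the same fixed-point equation
and uniqueness applies. -/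
theorem reflect_mem_fractal (hN : S.IsNormalization b p) (h : ℤ) {u : ℂ}
    (hu : b + p * u ∈ S.fractal) :
    b + p * (axis S.k (2 * h) * (starRingEnd ℂ) u) ∈ S.fractal := by
  set σ : ℂ → ℂ := fun z => b + p * (axis S.k (2 * h) * (starRingEnd ℂ) ((z - b) / p)) with hσ
  have hp := hN.ne_zero
  have hσu : ∀ u, σ (b + p * u) = b + p * (axis S.k (2 * h) * (starRingEnd ℂ) u) := by
    intro u
    simp only [hσ, add_sub_cancel_left, mul_div_cancel_left₀ u hp]
  have hcoord : ∀ z : ℂ, ∃ u, z = b + p * u := fun z =>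
    ⟨(z - b) / p, by rw [mul_div_cancel₀ _ hp, add_sub_cancel]⟩
  have hcomm : ∀ i j, S.cellCenter b p j = axis S.k (2 * h) *
      (starRingEnd ℂ) (S.cellCenter b p i) → ∀ z, σ (S.Ψ i z) = S.Ψ j (σ z) := by
    intro i j hij z
    obtain ⟨u, rfl⟩ := hcoord z
    rw [hσu, S.Ψ_eq hp, S.Ψ_eq hp, hij,
      show b + p / S.L * (S.cellCenter b p i + u) = b + p * ((S.cellCenter b p i + u) / S.L) by
        ring, hσu, map_div₀, conj_ofReal, map_add]
    ring
  have hcont : Continuous σ := by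
    rw [hσ]
    refine continuous_const.add (continuous_const.mul (continuous_const.mul ?_))
    exact continuous_conj.comp ((continuous_id.sub continuous_const).div_const p)
  have hfix : σ '' S.fractal = ⋃ i, S.Ψ i '' (σ '' S.fractal) := by
    apply Set.Subset.antisymm
    · rintro _ ⟨z, hz, rfl⟩
      obtain ⟨i, z', hz', rfl⟩ := S.exists_Ψ_eq_of_mem_fractal hz
      obtain ⟨j, hj⟩ := hN.reflect h i
      rw [hcomm i j hj]
      exact Set.mem_iUnion.2 ⟨j, _, ⟨z', hz', rfl⟩, rfl⟩
    · intro z hz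
      obtain ⟨j, _, ⟨z', hz', rfl⟩, rfl⟩ := Set.mem_iUnion.1 hz
      obtain ⟨i, hi⟩ := hN.reflect h j
      rw [← hcomm i j (by rw [hi, map_mul, axis.conj, conj_conj, ← mul_assoc, axis.mul_neg_self,
        one_mul])]
      exact ⟨_, S.Ψ_mem_fractal i hz', rfl⟩
  have huniq : σ '' S.fractal = S.fractal := S.existsUnique_fractal.unique
    ⟨S.fractal_spec.1.image σ, S.isCompact_fractal.image hcont, hfix⟩ S.fractal_spec
  rw [← hσu, ← huniq]
  exact ⟨_, hu, rfl⟩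

theorem exists_corner (hN : S.IsNormalization b p) (m : ℤ) :
    ∃ i, S.cellCenter b p i = (S.L - 1) * axis S.k (2 * m) ∧
      S.Ψ i (b + p * axis S.k (2 * m)) = b + p * axis S.k (2 * m) := by
  obtain ⟨⟨i, hi⟩, -⟩ := hN.vertex_mem_essential m
  refine ⟨i, ?_, hi⟩
  have hL := S.L_ne_zero
  have h := hi
  rw [S.Ψ_eq hN.ne_zero, add_right_inj, div_mul_eq_mul_div, div_eq_iff hL, mul_assoc] at h
  have := mul_left_cancel₀ hN.ne_zero h
  linear_combination this

/-- Equal centres give equal maps, which the open set condition forbids. -/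
theorem cellCenter_injective (hS : S.IsSimpleNestedFractal) (hN : S.IsNormalization b p) :
    Function.Injective (S.cellCenter b p) := by
  intro i j hij
  by_contra hne
  obtain ⟨U, -, ⟨z, hz⟩, hU, -⟩ := hS.openSet
  have : S.Ψ i z = S.Ψ j z := by
    obtain ⟨u, rfl⟩ : ∃ u, z = b + p * u :=
      ⟨(z - b) / p, by rw [mul_div_cancel₀ _ hN.ne_zero, add_sub_cancel]⟩
    rw [hN.Ψ_eq_Ψ_iff, hij]
  exact (hU i j hne).subset ⟨⟨z, hz, rfl⟩, ⟨z, hz, this.symm⟩⟩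

theorem isLinked (hS : S.IsSimpleNestedFractal) (hN : S.IsNormalization b p) :
    IsLinked S.k (Set.range (S.cellCenter b p)) := by
  rintro P ⟨_, ⟨a₀, rfl⟩, h₀⟩ step _ ⟨a, rfl⟩
  refine S.forall_index hS (P := fun a => P (S.cellCenter b p a)) h₀ ?_ a
  rintro a c ⟨-, ⟨s, hs, rfl⟩, ⟨t, ht, hst⟩⟩ hP
  obtain ⟨m, rfl⟩ := (hN.mem_essential _).1 hs
  obtain ⟨n, rfl⟩ := (hN.mem_essential _).1 ht
  exact step _ ⟨a, rfl⟩ _ ⟨c, rfl⟩ m n ((hN.Ψ_eq_Ψ_iff a c _ _).1 hst.symm) hP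

theorem isPolygonFractal (hS : S.IsSimpleNestedFractal) (hk : 3 ≤ S.k)
    (hN : S.IsNormalization b p) :
    IsPolygonFractal S.k S.L {u | b + p * u ∈ S.fractal} (Set.range (S.cellCenter b p)) where
  three_le := hk
  one_lt := S.one_lt_L
  isPreconnected := by
    have hp := hN.ne_zero
    have : {u | b + p * u ∈ S.fractal} = (fun z => (z - b) / p) '' S.fractal := by
      ext u
      constructor
      · intro hu
        exact ⟨_, hu, by simp only [add_sub_cancel_left, mul_div_cancel_left₀ u hp]⟩
      · rintro ⟨z, hz, rfl⟩
        rw [Set.mem_ofPred_eq, mul_div_cancel₀ _ hp, add_sub_cancel]; exact hz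
    rw [this]
    exact (S.isPreconnected_fractal hS).image _
      ((continuous_id.sub continuous_const).div_const p).continuousOn
  vertex_mem m := S.essential_subset_fractal (hN.vertex_mem_essential m)
  segment_mem m n := by
    obtain ⟨i, hi, -⟩ := hN.exists_corner m
    have h1 := S.Ψ_mem_fractal i (S.essential_subset_fractal (hN.vertex_mem_essential n))
    rw [S.Ψ_eq hN.ne_zero, hi] at h1
    rw [Set.mem_ofPred_eq]
    convert h1 using 2
    have hL := S.L_ne_zero
    field_simp
    ring
  reflect_mem h u hu := hN.reflect_mem_fractal h hu
  reflect_center_mem := by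
    rintro h _ ⟨i, rfl⟩
    obtain ⟨j, hj⟩ := hN.reflect h i
    exact ⟨j, hj⟩
  nesting := by
    rintro _ ⟨i, rfl⟩ _ ⟨j, rfl⟩ hij z hz z' hz' hzz
    have hne : i ≠ j := fun h => hij (by rw [h])
    have h1 := (hN.Ψ_eq_Ψ_iff i j z z').2 hzz
    have h2 := (hS.nesting i j hne).subset ⟨⟨_, hz, rfl⟩, ⟨_, hz', h1.symm⟩⟩
    obtain ⟨⟨s, hs, hs'⟩, -⟩ := h2
    rw [S.Ψ_injective i hs'] at hs
    obtain ⟨m, hm⟩ := (hN.mem_essential _).1 hs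
    exact ⟨m, mul_left_cancel₀ hN.ne_zero (add_left_cancel hm)⟩
  isLinked := hN.isLinked hS
  exists_ne_zero := by
    obtain ⟨i, hi, -⟩ := hN.exists_corner 0
    refine ⟨_, ⟨i, rfl⟩, ?_⟩
    rw [hi]
    refine mul_ne_zero ?_ (axis.ne_zero _)
    rw [sub_ne_zero]
    exact_mod_cast S.one_lt_L.ne'

end IsNormalization

end SimilitudeSystem

/-! ### Labellings of cells versus potentials -/

namespace SimilitudeSystem

variable {S : SimilitudeSystem} {b p : ℂ}

theorem IsNormalization.mem_vertices (hN : S.IsNormalization b p) {M : ℤ} {t v : ℂ} :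
    v ∈ S.vertices M t ↔ ∃ m : ℤ, v = (S.L : ℂ) ^ M * (b + p * axis S.k (2 * m)) + t := by
  constructor
  · rintro ⟨z, hz, rfl⟩
    obtain ⟨m, rfl⟩ := (hN.mem_essential z).1 hz
    exact ⟨m, rfl⟩
  · rintro ⟨m, rfl⟩
    exact ⟨_, hN.vertex_mem_essential m, rfl⟩

theorem IsNormalization.barycenter_eq (hN : S.IsNormalization b p) (hk : 2 ≤ S.k) (M : ℤ) (t : ℂ) :
    S.barycenter M t = (S.L : ℂ) ^ M * b + t := by
  have hLM : (S.L : ℂ) ^ M ≠ 0 := zpow_ne_zero M S.L_ne_zero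
  set F : ℕ → ℂ := fun n => (S.L : ℂ) ^ M * (b + p * axis S.k (2 * (n : ℤ))) + t with hF
  have hinj : Set.InjOn F (Finset.range S.k) := by
    intro m hm n hn hmn
    have h1 : axis S.k (2 * (m : ℤ)) = axis S.k (2 * (n : ℤ)) := mul_left_cancel₀ hN.ne_zero
      (add_left_cancel (mul_left_cancel₀ hLM (add_right_cancel hmn)))
    rw [axis.vertex_eq_pow, axis.vertex_eq_pow] at h1
    exact (axis.isPrimitiveRoot (by omega)).pow_inj (Finset.mem_range.1 hm)
      (Finset.mem_range.1 hn) h1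
  have hvert : S.vertices M t = ((Finset.range S.k).image F : Finset ℂ) := by
    ext v
    rw [hN.mem_vertices, Finset.mem_coe, Finset.mem_image]
    constructor
    · rintro ⟨m, rfl⟩
      obtain ⟨j, hj0, hjk, hj⟩ := axis.exists_nat_lt (show S.k ≠ 0 by omega) m
      lift j to ℕ using hj0
      exact ⟨j, Finset.mem_range.2 (by exact_mod_cast hjk), by rw [hF, hj]⟩
    · rintro ⟨n, -, rfl⟩
      exact ⟨n, rfl⟩
  have hk0 : (S.k : ℂ) ≠ 0 := by exact_mod_cast (show S.k ≠ 0 by omega)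
  rw [barycenter, hvert, Set.ncard_coe_finset, Finset.card_image_of_injOn hinj, Finset.card_range,
    finsum_mem_coe_finset, Finset.sum_image hinj]
  simp only [hF]
  rw [Finset.sum_add_distrib, ← Finset.mul_sum, Finset.sum_add_distrib, ← Finset.mul_sum,
    axis.sum_vertex hk]
  simp only [Finset.sum_const, Finset.card_range, nsmul_eq_mul, mul_zero, add_zero]
  field_simp

theorem IsNormalization.rotation_eq (hN : S.IsNormalization b p) (hk : 2 ≤ S.k) (M j m : ℤ) :
    S.rotation M j ((S.L : ℂ) ^ M * (b + p * axis S.k (2 * m))) =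
      (S.L : ℂ) ^ M * (b + p * axis S.k (2 * (m + j))) := by
  have e : exp (((2 * Real.pi * j / S.k : ℝ) : ℂ) * I) = axis S.k (2 * j) := by
    rw [axis.eq_exp]; congr 3; push_cast; ring
  rw [rotation, hN.barycenter_eq hk, e, mul_add 2 m j, axis.add]
  ring

section scaled

theorem scaled_subset_succ (h0 : ∃ i, S.ν i = 0) (M : ℤ) : S.scaled M ⊆ S.scaled (M + 1) := by
  rintro _ ⟨z, hz, rfl⟩
  obtain ⟨i, hi⟩ := h0
  refine ⟨_, S.Ψ_mem_fractal i hz, ?_⟩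
  have hL := S.L_ne_zero
  rw [Ψ, hi, add_zero, zpow_add₀ hL, zpow_one]
  field_simp

theorem scaled_subset_add (h0 : ∃ i, S.ν i = 0) (M : ℤ) (n : ℕ) :
    S.scaled M ⊆ S.scaled (M + n) := by
  induction n with
  | zero => simp
  | succ n ih =>
    refine ih.trans ((scaled_subset_succ h0 _).trans ?_)
    rw [Nat.cast_succ, add_assoc]

theorem scaled_subset_unbounded (h0 : ∃ i, S.ν i = 0) (M : ℤ) : S.scaled M ⊆ S.unbounded := by
  refine (scaled_subset_add h0 M (-M).toNat).trans ?_
  obtain ⟨n, hn⟩ : ∃ n : ℕ, M + ((-M).toNat : ℤ) = n := ⟨(M + (-M).toNat).toNat, by omega⟩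
  rw [hn]
  exact Set.subset_iUnion (fun n : ℕ => S.scaled n) n

theorem add_mem_scaled {M : ℤ} {z : ℂ} (hz : z ∈ S.scaled M) (a : Fin S.N) :
    z + (S.L : ℂ) ^ (M + 1) * S.ν a ∈ S.scaled (M + 1) := by
  obtain ⟨z, hz, rfl⟩ := hz
  refine ⟨_, S.Ψ_mem_fractal a hz, ?_⟩
  have hL := S.L_ne_zero
  simp only [Ψ]
  rw [zpow_add₀ hL, zpow_one]
  field_simp

theorem isComplexShift_single (h0 : ∃ i, S.ν i = 0) (M : ℤ) (a : Fin S.N) :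
    S.IsComplexShift M ((S.L : ℂ) ^ (M + 1) * S.ν a) := by
  refine ⟨?_, M + 1, le_rfl, fun _ => a, by simp⟩
  rintro _ ⟨z, hz, rfl⟩
  exact scaled_subset_unbounded h0 _ (add_mem_scaled hz a)

end scaled

/-- Scaling by `L ^ M` makes the `0`-complexes of `K^⟨1⟩` into `M`-complexes, so a good labelling
can be pulled back. -/
theorem canBeWellLabelled_of_hasGLP (hk : 2 ≤ S.k) (h0 : ∃ i, S.ν i = 0)
    (hN : S.IsNormalization b p) (h : S.HasGLP) (C : Set (Fin S.N)) : S.CanBeWellLabelled C := by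
  obtain ⟨M, l, hbij, hl⟩ := h
  have hL := S.L_ne_zero
  have hmem : ∀ (t v : ℂ), v ∈ S.vertices 0 t ↔
      (S.L : ℂ) ^ M * v ∈ S.vertices M ((S.L : ℂ) ^ M * t) := by
    intro t v
    rw [hN.mem_vertices, hN.mem_vertices]
    refine exists_congr fun m => ?_
    rw [zpow_zero, one_mul, ← mul_add, mul_right_inj' (zpow_ne_zero M hL)]
  refine ⟨fun z => l ((S.L : ℂ) ^ M * z), fun z => l ((S.L : ℂ) ^ M * z), ?_, fun a _ => ?_⟩
  · have h1 : Set.BijOn (fun z => (S.L : ℂ) ^ M * z) (S.vertices 0 0) (S.vertices M 0) := by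
      refine ⟨fun v hv => ?_, (mul_right_injective₀ (zpow_ne_zero M hL)).injOn, fun v hv => ?_⟩
      · simpa using (hmem 0 v).1 hv
      · have e : (S.L : ℂ) ^ M * (((S.L : ℂ) ^ M)⁻¹ * v) = v :=
          mul_inv_cancel_left₀ (zpow_ne_zero M hL) v
        exact ⟨((S.L : ℂ) ^ M)⁻¹ * v, (hmem 0 _).2 (by rw [e, mul_zero]; exact hv), e⟩
    exact hbij.comp h1
  · obtain ⟨j, hj⟩ := hl _ (isComplexShift_single h0 M a)
    have e : (S.L : ℂ) ^ (M + 1) * S.ν a = (S.L : ℂ) ^ M * S.cellShift a := by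
      rw [cellShift, zpow_add₀ hL, zpow_one, mul_assoc]
    refine ⟨j, fun v hv => ?_⟩
    simp only
    rw [hj _ (by rw [e]; exact (hmem _ v).1 hv), e]
    obtain ⟨m, rfl⟩ := hN.mem_vertices.1 hv
    rw [add_sub_cancel_right, hN.rotation_eq hk, zpow_zero, one_mul, one_mul, mul_add _ (b + _),
      add_sub_cancel_right, hN.rotation_eq hk]

theorem IsNormalization.cellShift_eq (hN : S.IsNormalization b p) (a : Fin S.N) :
    b + S.cellShift a = S.L * b + p * S.cellCenter b p a := by
  have := hN.ne_zero
  rw [cellShift, cellCenter]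
  field_simp
  ring

/-- Injectivity of the reference labelling turns equal labels at a common vertex into equal
positions modulo `k`. -/
theorem exists_isPotential_of_canBeWellLabelled (hS : S.IsSimpleNestedFractal) (hk : 2 ≤ S.k)
    (hN : S.IsNormalization b p) {C : Set (Fin S.N)} (h : S.CanBeWellLabelled C) :
    ∃ g, IsPotential S.k (S.cellCenter b p '' C) g := by
  obtain ⟨q, l, hq, hl⟩ := h
  have hl' : ∀ a, ∃ j : ℤ, a ∈ C → ∀ v ∈ S.vertices 0 (S.cellShift a),
      l v = q (S.rotation 0 j (v - S.cellShift a)) := by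
    intro a
    by_cases ha : a ∈ C
    · obtain ⟨j, hj⟩ := hl a ha
      exact ⟨j, fun _ => hj⟩
    · exact ⟨0, fun h => absurd h ha⟩
  choose j hj using hl'
  have hinj := hN.cellCenter_injective hS
  refine ⟨Function.extend (S.cellCenter b p) (fun a => (j a : ZMod S.k)) 0, ?_⟩
  rintro _ ⟨a, ha, rfl⟩ _ ⟨c, hc, rfl⟩ m n hmn
  rw [hinj.extend_apply, hinj.extend_apply]
  have hvert : ∀ (a : Fin S.N) (m : ℤ), a ∈ C →
      l (b + p * axis S.k (2 * m) + S.cellShift a) = q (b + p * axis S.k (2 * (m + j a))) := by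
    intro a m ha
    rw [hj a ha _ (hN.mem_vertices.2 ⟨m, by simp⟩), add_sub_cancel_right]
    have := hN.rotation_eq hk 0 (j a) m
    rw [zpow_zero, one_mul, one_mul] at this
    rw [this]
  have hv : b + p * axis S.k (2 * m) + S.cellShift a =
      b + p * axis S.k (2 * n) + S.cellShift c := by
    linear_combination hN.cellShift_eq a - hN.cellShift_eq c + p * hmn
  have h1 := hvert a m ha
  rw [hv, hvert c n hc] at h1
  have h2 := hq.injOn (hN.mem_vertices.2 ⟨n + j c, by simp⟩) (hN.mem_vertices.2 ⟨m + j a, by simp⟩)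
    h1
  have h3 := mul_left_cancel₀ hN.ne_zero (add_left_cancel h2)
  rw [axis.vertex_eq_iff (by omega)] at h3
  push_cast at h3
  exact h3.symm

/-- The two sectors span the chambers `2 * i` to `2 * i + 3`; the last three avoid the excluded edge
at angle `2 π i / k`. -/
theorem mem_slice_of_mem_chamber (hk : 2 ≤ S.k) (hN : S.IsNormalization b p) (i : ℤ)
    {a : Fin S.N} (ha0 : S.cellCenter b p a ≠ 0)
    (ha : S.cellCenter b p a ∈ chamber S.k (2 * (i + 1) - 1) ∪ chamber S.k (2 * (i + 1)) ∪
      chamber S.k (2 * (i + 1) + 1)) :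
    a ∈ S.slice (S.L * (b + p)) i ∪ S.slice (S.L * (b + p)) (i + 1) := by
  have hkp : (0 : ℝ) < S.k := by exact_mod_cast (show 0 < S.k by omega)
  have hpi := Real.pi_pos
  obtain ⟨r, hr, θ, h1, h2, hx⟩ : ∃ r : ℝ, 0 ≤ r ∧ ∃ θ : ℝ, Real.pi * (2 * i + 1) ≤ θ * S.k ∧
      θ * S.k ≤ Real.pi * (2 * i + 4) ∧ S.cellCenter b p a = r * exp ((θ : ℂ) * I) := by
    rcases ha with (⟨r, hr, θ, ⟨h1, h2⟩, hx⟩ | ⟨r, hr, θ, ⟨h1, h2⟩, hx⟩) |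
      ⟨r, hr, θ, ⟨h1, h2⟩, hx⟩ <;>
    · rw [div_le_iff₀ hkp] at h1
      rw [le_div_iff₀ hkp] at h2
      push_cast at h1 h2
      exact ⟨r, hr, θ, by nlinarith, by nlinarith, hx⟩
  have hr0 : 0 < r := lt_of_le_of_ne hr fun h => ha0 (by rw [hx, ← h]; simp)
  have hsector : ∀ n : ℤ, θ ∈ Set.Ioc (2 * Real.pi * n / S.k) (2 * Real.pi * (n + 1) / S.k) →
      a ∈ S.slice (S.L * (b + p)) n := by
    intro n hn
    refine ⟨r / S.L, div_pos hr0 S.L_pos, θ, hn, ?_⟩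
    have hL := S.L_ne_zero
    rw [hN.barycenter_eq hk, hN.barycenter_eq hk, zpow_zero, one_mul, hN.cellShift_eq, hx, zpow_one]
    push_cast
    field_simp
    ring
  rcases le_total θ (2 * Real.pi * (i + 1) / S.k) with h | h
  · refine .inl (hsector i ⟨?_, h⟩)
    rw [div_lt_iff₀ hkp]; nlinarith
  · by_cases h' : θ = 2 * Real.pi * (i + 1) / S.k
    · refine .inl (hsector i ⟨?_, h'.le⟩)
      rw [div_lt_iff₀ hkp]; nlinarith
    · refine .inr (hsector (i + 1) ⟨?_, ?_⟩)
      · push_cast; exact lt_of_le_of_ne h (Ne.symm h')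
      · rw [le_div_iff₀ hkp]; push_cast; nlinarith

/-! ### From a potential to a labelling of the unbounded fractal -/

/-- The translation vectors of the `0`-complexes in `K^⟨n⟩`. -/
def shifts (S : SimilitudeSystem) : ℕ → Set ℂ
  | 0 => {0}
  | n + 1 => {t | ∃ s ∈ shifts S n, ∃ a, t = s + (S.L : ℂ) ^ ((n : ℤ) + 1) * S.ν a}

theorem add_mem_scaled_of_mem_shifts {z : ℂ} (hz : z ∈ S.fractal) {n : ℕ} :
    ∀ {t : ℂ}, t ∈ S.shifts n → z + t ∈ S.scaled n := by
  induction n with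
  | zero =>
    rintro t ht
    rw [Set.mem_singleton_iff.1 ht, add_zero]
    exact ⟨z, hz, by simp⟩
  | succ n ih =>
    rintro _ ⟨s, hs, a, rfl⟩
    rw [← add_assoc]
    exact_mod_cast add_mem_scaled (ih hs) a

theorem exists_mem_shifts {t : ℂ} (ht : S.IsComplexShift 0 t) : ∃ n, t ∈ S.shifts n := by
  obtain ⟨-, J, hJ, a, rfl⟩ := ht
  lift J to ℕ using by omega
  refine ⟨J, ?_⟩
  clear hJ
  induction J with
  | zero => simp [shifts]
  | succ n ih =>
    have e : Finset.Icc (0 + 1 : ℤ) ((n + 1 : ℕ) : ℤ) =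
        insert ((n : ℤ) + 1) (Finset.Icc (0 + 1 : ℤ) n) := by
      ext j
      simp only [Finset.mem_Icc, Finset.mem_insert]
      omega
    rw [e, Finset.sum_insert (by simp), add_comm (_ * _)]
    exact ⟨_, ih, _, rfl⟩

/-- `l` labels the vertices of the `0`-complexes in `K^⟨n⟩` consistently, and its labels of the
vertices of `K^⟨n⟩` depend on their position in an affine way. -/
structure IsVertexLabelling (S : SimilitudeSystem) (b p : ℂ) (n : ℕ) (l : ℂ → ZMod S.k) : Prop where
  cell : ∀ t ∈ S.shifts n, ∃ j : ZMod S.k, ∀ m : ℤ, l (b + p * axis S.k (2 * m) + t) = m + j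
  corner : ∃ α β : ZMod S.k, ∀ m : ℤ,
    l ((S.L : ℂ) ^ n * (b + p * axis S.k (2 * m))) = α * m + β

theorem exists_isVertexLabelling_zero (hk : 2 ≤ S.k) (hN : S.IsNormalization b p) :
    ∃ l, IsVertexLabelling S b p 0 l ∧ ∀ m : ℤ, l (b + p * axis S.k (2 * m)) = m := by
  have h : ∀ z : ℂ, ∃ c : ZMod S.k, ∀ m : ℤ, z = b + p * axis S.k (2 * m) → c = m := by
    intro z
    by_cases hz : ∃ m : ℤ, z = b + p * axis S.k (2 * m)
    · obtain ⟨m, hm⟩ := hz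
      refine ⟨m, fun n hn => ?_⟩
      rw [hm] at hn
      exact (axis.vertex_eq_iff (by omega) m n).1
        (mul_left_cancel₀ hN.ne_zero (add_left_cancel hn))
    · exact ⟨0, fun m hm => absurd ⟨m, hm⟩ hz⟩
  choose l hl using h
  refine ⟨l, ⟨fun t ht => ⟨0, fun m => ?_⟩, 1, 0, fun m => ?_⟩, fun m => hl _ m rfl⟩
  · rw [Set.mem_singleton_iff.1 ht, add_zero, add_zero]
    exact hl _ m rfl
  · rw [pow_zero, one_mul, one_mul, add_zero]
    exact hl _ m rfl

/-- The rotation of a corner cell depends on its position in an affine way. -/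
theorem exists_corner_eq (hS : S.IsSimpleNestedFractal) (hk : 3 ≤ S.k)
    (hN : S.IsNormalization b p) {f : ℂ → ZMod S.k}
    (hf : IsPotential S.k (Set.range (S.cellCenter b p)) f) :
    ∃ c d : ZMod S.k, ∀ m : ℤ, f ((S.L - 1) * axis S.k (2 * m)) = c * m + d := by
  have hF := hN.isPolygonFractal hS hk
  -- Rotation preserves `X`, so the rotated potential differs from `f` by a constant.
  obtain ⟨c, hc⟩ := hf.exists_eq_add_const hF.isLinked ((hf.rotate 1).mono fun x hx =>
    rotate_mem_of_reflect_mem hF.reflect_center_mem 1 hx)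
  have hmem : ∀ m : ℤ, ((S.L : ℂ) - 1) * axis S.k (2 * m) ∈ Set.range (S.cellCenter b p) := by
    intro m
    obtain ⟨i, hi, -⟩ := hN.exists_corner m
    exact ⟨i, hi⟩
  have hstep : ∀ m : ℤ, f ((S.L - 1) * axis S.k (2 * (m + 1))) =
      f ((S.L - 1) * axis S.k (2 * m)) + c := by
    intro m
    rw [← hc _ (hmem m), mul_left_comm, ← axis.add]
    congr 3; ring
  refine ⟨c, f ((S.L - 1) * axis S.k (2 * 0)), fun m => ?_⟩
  induction m with
  | zero => simp
  | succ i ih => rw [hstep, ih]; push_cast; ring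
  | pred i ih =>
    have := hstep (-(i : ℤ) - 1)
    rw [sub_add_cancel, ih] at this
    push_cast at this ⊢
    linear_combination -this

/-- The copy of `K^⟨n⟩` with index `a` gets the labels `l` shifted by `α` times its rotation. Copies
meet only in corners, labelled `α m + β`, so consistency is the potential condition multiplied by
`α`. A corner of `K^⟨n+1⟩` is the corresponding corner of a corner copy, so the affine law persists.
The copy with `ν i₀ = 0` is `K^⟨n⟩` itself and keeps its labels as `f` vanishes there. -/
theorem IsVertexLabelling.exists_succ (hS : S.IsSimpleNestedFractal) (hk : 3 ≤ S.k)
    (hN : S.IsNormalization b p) {f : ℂ → ZMod S.k}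
    (hf : IsPotential S.k (Set.range (S.cellCenter b p)) f)
    {i₀ : Fin S.N} (hi₀ : S.ν i₀ = 0) (hfi₀ : f (S.cellCenter b p i₀) = 0) {n : ℕ}
    {l : ℂ → ZMod S.k} (hl : IsVertexLabelling S b p n l) :
    ∃ l', IsVertexLabelling S b p (n + 1) l' ∧ Set.EqOn l' l (S.scaled n) := by
  have hL := S.L_ne_zero
  obtain ⟨α, β, hαβ⟩ := hl.corner
  obtain ⟨c, d, hcd⟩ := exists_corner_eq hS hk hN hf
  have hex : ∀ v : ℂ, ∃ s : ZMod S.k, ∀ a, v - (S.L : ℂ) ^ ((n : ℤ) + 1) * S.ν a ∈ S.scaled n →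
      s = l (v - (S.L : ℂ) ^ ((n : ℤ) + 1) * S.ν a) + α * f (S.cellCenter b p a) := by
    intro v
    by_cases hv : ∃ a, v - (S.L : ℂ) ^ ((n : ℤ) + 1) * S.ν a ∈ S.scaled n
    · obtain ⟨a, ha⟩ := hv
      refine ⟨l (v - (S.L : ℂ) ^ ((n : ℤ) + 1) * S.ν a) + α * f (S.cellCenter b p a),
        fun a' ha' => ?_⟩
      by_cases haa : a = a'
      · rw [haa]
      obtain ⟨z, hz, hza⟩ := ha
      obtain ⟨z', hz', hza'⟩ := ha'
      have h1 : S.Ψ a z = S.Ψ a' z' := by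
        have e : z + S.L * S.ν a = z' + S.L * S.ν a' := by
          refine mul_left_cancel₀ (zpow_ne_zero (n : ℤ) hL) ?_
          simp only [zpow_add₀ hL, zpow_one] at hza hza'
          linear_combination hza - hza'
        rw [Ψ, Ψ]
        field_simp
        exact e
      simp only at hza hza'
      obtain ⟨⟨x, hx, hxz⟩, ⟨y, hy, hyz⟩⟩ :=
        (hS.nesting a a' haa).subset ⟨⟨z, hz, rfl⟩, ⟨z', hz', h1.symm⟩⟩
      rw [h1] at hyz
      obtain ⟨m, hm⟩ := (hN.mem_essential x).1 hx
      obtain ⟨m', hm'⟩ := (hN.mem_essential y).1 hy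
      rw [hm'] at hyz
      rw [S.Ψ_injective a hxz |>.symm] at hza h1
      have hz'm := S.Ψ_injective a' hyz
      rw [hm] at hza h1
      rw [← hz'm] at hza' h1
      rw [← hza, ← hza', zpow_natCast, hαβ, hαβ]
      have h2 := hf _ ⟨a, rfl⟩ _ ⟨a', rfl⟩ m m' ((hN.Ψ_eq_Ψ_iff a a' _ _).1 h1)
      linear_combination α * h2
    · exact ⟨0, fun a ha => absurd ⟨a, ha⟩ hv⟩
  choose l' hl' using hex
  refine ⟨l', ⟨?_, α * (1 + c), β + α * d, fun m => ?_⟩, fun v hv => ?_⟩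
  · rintro _ ⟨t, ht, a, rfl⟩
    obtain ⟨j, hj⟩ := hl.cell t ht
    refine ⟨j + α * f (S.cellCenter b p a), fun m => ?_⟩
    have e : b + p * axis S.k (2 * m) + (t + (S.L : ℂ) ^ ((n : ℤ) + 1) * S.ν a) -
        (S.L : ℂ) ^ ((n : ℤ) + 1) * S.ν a = b + p * axis S.k (2 * m) + t := by ring
    rw [hl' _ a (by
      rw [e]
      exact add_mem_scaled_of_mem_shifts
        (S.essential_subset_fractal (hN.vertex_mem_essential m)) ht), e, hj]
    ring
  · obtain ⟨i, hi, hfix⟩ := hN.exists_corner m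
    have e : (S.L : ℂ) ^ (n + 1) * (b + p * axis S.k (2 * m)) -
        (S.L : ℂ) ^ ((n : ℤ) + 1) * S.ν i = (S.L : ℂ) ^ n * (b + p * axis S.k (2 * m)) := by
      rw [Ψ] at hfix
      rw [zpow_add₀ hL, zpow_one, zpow_natCast, pow_succ]
      field_simp at hfix
      linear_combination -(S.L : ℂ) ^ n * hfix
    rw [hl' _ i (by
      rw [e, ← zpow_natCast]
      exact ⟨_, S.essential_subset_fractal (hN.vertex_mem_essential m), rfl⟩), e, hαβ, hi, hcd]
    ring
  · rw [hl' v i₀ (by rwa [hi₀, mul_zero, sub_zero]), hi₀, hfi₀, mul_zero, mul_zero, sub_zero,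
      add_zero]

theorem hasGLP_of_isPotential (hS : S.IsSimpleNestedFractal) (hk : 3 ≤ S.k)
    (h0 : ∃ i, S.ν i = 0) (hN : S.IsNormalization b p) {f : ℂ → ZMod S.k}
    (hf : IsPotential S.k (Set.range (S.cellCenter b p)) f) : S.HasGLP := by
  have hk0 : S.k ≠ 0 := by omega
  obtain ⟨i₀, hi₀⟩ := h0
  obtain ⟨l₀, hl₀, hl₀m⟩ := exists_isVertexLabelling_zero (by omega) hN
  have hstep : ∀ (n : ℕ) (l : {l // IsVertexLabelling S b p n l}),
      ∃ l' : {l // IsVertexLabelling S b p (n + 1) l}, Set.EqOn l'.1 l.1 (S.scaled n) := by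
    intro n l
    -- Normalizing the potential to vanish at `i₀` makes each labelling extend the preceding one, so
    -- that they have a limit.
    obtain ⟨l', h, h'⟩ := IsVertexLabelling.exists_succ hS hk hN
      (hf.add_const (-f (S.cellCenter b p i₀))) hi₀ (add_neg_cancel _) l.2
    exact ⟨⟨l', h⟩, h'⟩
  choose next hnext using hstep
  let lab : ∀ n, {l // IsVertexLabelling S b p n l} := fun n => Nat.rec ⟨l₀, hl₀⟩ next n
  have hlab : ∀ (n : ℕ) (v : ℂ), v ∈ S.scaled n → ∀ m : ℕ, n ≤ m → (lab m).1 v = (lab n).1 v := by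
    intro n v hv m hnm
    induction m, hnm using Nat.le_induction with
    | base => rfl
    | succ m hnm ih =>
      rw [← ih]
      obtain ⟨q, rfl⟩ := Nat.exists_eq_add_of_le hnm
      refine hnext _ (lab (n + q)) ?_
      rw [Nat.cast_add]
      exact scaled_subset_add ⟨i₀, hi₀⟩ n q hv
  have hlim : ∀ v : ℂ, ∃ s : ZMod S.k, ∀ n : ℕ, v ∈ S.scaled n → s = (lab n).1 v := by
    intro v
    by_cases hv : ∃ n : ℕ, v ∈ S.scaled n
    · obtain ⟨n, hn⟩ := hv
      refine ⟨(lab n).1 v, fun m hm => ?_⟩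
      rcases le_total n m with h | h
      · exact (hlab n v hn m h).symm
      · exact hlab m v hm n h
    · exact ⟨0, fun n hn => absurd ⟨n, hn⟩ hv⟩
  choose l hl using hlim
  have hcell : ∀ (n : ℕ) (t : ℂ), t ∈ S.shifts n → ∃ j : ZMod S.k, ∀ m : ℤ,
      l (b + p * axis S.k (2 * m) + t) = m + j := by
    intro n t ht
    obtain ⟨j, hj⟩ := (lab n).2.cell t ht
    refine ⟨j, fun m => ?_⟩
    rw [hl _ n (add_mem_scaled_of_mem_shifts
      (S.essential_subset_fractal (hN.vertex_mem_essential m)) ht), hj]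
  have hbase : ∀ m : ℤ, l (b + p * axis S.k (2 * m)) = m := by
    intro m
    rw [hl _ 0 (by
      simpa using add_mem_scaled_of_mem_shifts (n := 0)
        (S.essential_subset_fractal (hN.vertex_mem_essential m)) (Set.mem_singleton 0))]
    exact hl₀m m
  have : NeZero S.k := ⟨hk0⟩
  set e := (ZMod.finEquiv S.k).symm
  refine ⟨0, fun v => e (l v), ⟨fun _ _ => Set.mem_univ _, ?_, ?_⟩, fun t ht => ?_⟩
  · intro v hv v' hv' hvv
    obtain ⟨m, rfl⟩ := hN.mem_vertices.1 hv
    obtain ⟨m', rfl⟩ := hN.mem_vertices.1 hv'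
    have h1 := e.injective hvv
    simp only [zpow_zero, one_mul, add_zero] at h1 ⊢
    rw [hbase, hbase] at h1
    rw [axis.vertex_periodic hk0 _ _ h1]
  · intro y _
    obtain ⟨m, hm⟩ := ZMod.intCast_surjective (e.symm y)
    refine ⟨b + p * axis S.k (2 * m), hN.mem_vertices.2 ⟨m, by simp⟩, ?_⟩
    simp only [hbase, hm, RingEquiv.apply_symm_apply]
  · obtain ⟨n, hn⟩ := exists_mem_shifts ht
    obtain ⟨j, hj⟩ := hcell n t hn
    obtain ⟨j', rfl⟩ := ZMod.intCast_surjective j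
    refine ⟨j', fun v hv => ?_⟩
    obtain ⟨m, rfl⟩ := hN.mem_vertices.1 hv
    have hrot := hN.rotation_eq (by omega) 0 j' m
    rw [zpow_zero, one_mul, one_mul] at hrot
    rw [zpow_zero, one_mul, add_sub_cancel_right, hrot]
    simp only [hj, hbase, Int.cast_add]

end SimilitudeSystem

/-! ### The equivalence -/

theorem mainTheorem4 (S : SimilitudeSystem) (hS : S.IsSimpleNestedFractal)
    (h0 : ∃ i, S.ν i = 0) (hk : 3 ≤ S.k)
    (h6 : S.k ≠ 6 ∨ (S.k = 6 ∧ S.barycenter 1 0 ∉ S.scaled 1))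
    (w : ℂ) (hw : w ∈ S.vertices 1 0) (i : ℤ) :
    S.HasGLP ↔ S.CanBeWellLabelled (S.slice w i ∪ S.slice w (i + 1)) := by
  have hk2 : 2 ≤ S.k := by omega
  obtain ⟨v, hv, hvw⟩ := hw
  obtain ⟨b, p, hN, rfl⟩ := S.exists_isNormalization hS hk hv
  obtain rfl : w = S.L * (b + p) := by simpa using hvw.symm
  refine ⟨fun h => SimilitudeSystem.canBeWellLabelled_of_hasGLP hk2 h0 hN h _, fun h => ?_⟩
  obtain ⟨g, hg⟩ := SimilitudeSystem.exists_isPotential_of_canBeWellLabelled hS hk2 hN h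
  -- A central cell belongs to a map fixing `b`, which puts the barycenter into the fractal.
  have hcentral : S.k = 6 → (0 : ℂ) ∉ Set.range (S.cellCenter b p) := by
    rintro hk6 ⟨a, ha⟩
    refine (h6.resolve_left (not_not.2 hk6)).2 ?_
    have hfix : S.Ψ a b = b := by
      have := S.Ψ_eq (b := b) hN.ne_zero a 0
      rwa [ha, mul_zero, add_zero, add_zero, mul_zero, add_zero] at this
    rw [hN.barycenter_eq hk2, add_zero]
    exact ⟨b, S.mem_fractal_of_fixed hfix, rfl⟩
  -- The middle chamber `2 * (i + 1)` begins at the common edge of the two sectors.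
  obtain ⟨f, hf⟩ := (hN.isPolygonFractal hS hk).exists_isPotential hcentral (i + 1)
    (hg.mono (by
      rintro _ ⟨⟨⟨a, rfl⟩, ha0⟩, ha⟩
      exact ⟨a, SimilitudeSystem.mem_slice_of_mem_chamber hk2 hN i ha0 ha, rfl⟩))
  exact SimilitudeSystem.hasGLP_of_isPotential hS hk h0 hN hf
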